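/- A UAV at mean position $(\mu_x,\mu_y,\mu_z)$, $\mu_x\neq 0$, points a laser beam at a lens lying in the plane $x=0$ and centered at the origin. The mean beam angles are $\mu_\theta=\pi+\arctan(\mu_y/\mu_x)$ if $\mu_x>0$, $\mu_\theta=\arctan(\mu_y/\mu_x)$ otherwise, and $\mu_\phi=\pi-\arccos\big(\mu_z/\sqrt{\mu_x^2+\mu_y^2+\mu_z^2}\big)$. The fluctuations $\epsilon_x,\epsilon_y,\epsilon_z,\epsilon_\theta,\epsilon_\phi$ are independent, with $\epsilon_s\sim\mathcal N(0,\sigma_s^2)$. To first order in the fluctuations, the center of the beam footprint on the lens plane is $$b_y=\epsilon_y+c_1\epsilon_x+c_2\epsilon_\theta,\qquad b_z=\epsilon_z+c_3\epsilon_\phi+c_4\epsilon_\theta+c_5\epsilon_x,$$ where $c_1=-\tan\mu_\theta$, $c_2=-\frac{\mu_x}{\cos^2\mu_\theta}$, $c_3=\frac{\mu_x}{\sin^2\mu_\phi\cos\mu_\theta}$, $c_4=-\frac{\mu_x\cot\mu_\phi\tan\mu_\theta}{\cos\mu_\theta}$, $c_5=-\frac{\cot\mu_\phi}{\cos\mu_\theta}$.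 Let $u=\sqrt{b_y^2+b_z^2}$, and let $A_0,t,w_L,\eta,h_p,\gamma_{\mathrm{thr}}$ be positive constants. Put $h_g=A_0\exp\!\big(-\frac{2u^2}{t w_L^2}\big)$. For transmit SNR $\bar\gamma$, the received SNR is $\eta^2h_p^2h_g^2\bar\gamma$ and the outage probability is $$P_{\mathrm{out}}(\bar\gamma)=\Pr\{\eta^2h_p^2h_g^2\bar\gamma\le\gamma_{\mathrm{thr}}\}.$$ Let $\lambda_1,\lambda_2$ be the eigenvalues of the covariance matrix $$\begin{bmatrix}\sigma_y^2+c_1^2\sigma_x^2+c_2^2\sigma_\theta^2 & c_1c_5\sigma_x^2+c_2c_4\sigma_\theta^2\\ c_1c_5\sigma_x^2+c_2c_4\sigma_\theta^2&\sigma_z^2+c_3^2\sigma_\phi^2+c_4^2\sigma_\theta^2+c_5^2\sigma_x^2\end{bmatrix},$$ and put $q=\sqrt{\min\{\lambda_1,\lambda_2\}/\max\{\lambda_1,\lambda_2\}}$ and $\Omega=\lambda_1+\lambda_2$. Assume $q>0$, i.e. both eigenvalues are positive. Define $$g=\sqrt{\tfrac{1+q^2}{\Omega}\,\tfrac{t w_L^2}{2}\ln\!\Big(\tfrac{\eta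 h_pA_0\sqrt{\bar\gamma}}{\sqrt{\gamma_{\mathrm{thr}}}}\Big)},\quad a=\tfrac{1+q}{2q}g,\quad b=\tfrac{1-q}{2q}g,\quad b_t=\tfrac{\sqrt{\gamma_{\mathrm{thr}}}}{\eta h_pA_0},\quad a_t=\frac{2\sqrt{2\Omega}\,b_t^{\frac{(1+q^2)tw_L^2}{4\Omega}}}{\sqrt{\pi(1-q^4)tw_L^2}}.$$ Let $Q(x)=\frac1{\sqrt{2\pi}}\int_x^\infty e^{-y^2/2}\,dy$ be the Gaussian Q-function and $Q(a,b)=\int_b^\infty x\,e^{-(x^2+a^2)/2}I_0(ax)\,dx$ the first-order Marcum Q-function, with $I_0$ the modified Bessel function of the first kind of order zero. Then the following hold. 1. For every $\bar\gamma>0$ with $\frac{\sqrt{\gamma_{\mathrm{thr}}}}{\eta h_p\sqrt{\bar\gamma}}\le A_0$, $\;P_{\mathrm{out}}=1-Q(a,b)+Q(b,a)$. 2. If $q<1$, then as $\bar\gamma\to\infty$ $$P_{\mathrm{out}}\sim\Big(\sqrt{\tfrac ab}+\sqrt{\tfrac ba}\Big)Q(a-b)\sim a_t\Big(\frac1{\bar\gamma}\Big)^{\frac{(1+q^2)tw_L^2}{8\Omega}}\Big[\ln\Big(\frac{\bar\gamma}{b_t^2}\Big)\Big]^{-1/2},$$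 where $f\sim h$ means $f/h\to1$. 3. The diversity order is $$-\lim_{\bar\gamma\to\infty}\frac{\ln P_{\mathrm{out}}}{\ln\bar\gamma}=\frac{(1+q^2)tw_L^2}{8\Omega}.$$ -/

import Mathlib

open MeasureTheory ProbabilityTheory Filter Asymptotics
open scoped Topology NNReal Matrix

/-- Modified Bessel function of the first kind of order zero (Bessel's integral). -/
noncomputable def besselI0 (z : ℝ) : ℝ :=
  (1 / Real.pi) * ∫ v in (0 : ℝ)..Real.pi, Real.exp (z * Real.cos v)

/-- First-order Marcum Q-function `Q(a, b)`. -/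
noncomputable def marcumQ (a b : ℝ) : ℝ :=
  ∫ x in Set.Ioi b, x * Real.exp (-(x ^ 2 + a ^ 2) / 2) * besselI0 (a * x)

/-- Gaussian Q-function. -/
noncomputable def gaussQ (x : ℝ) : ℝ :=
  ∫ y in Set.Ioi x, Real.exp (-y ^ 2 / 2) / Real.sqrt (2 * Real.pi)

/-- The five fluctuating coordinates of the UAV: its position `x, y, z` and the angles `θ, φ`
of its laser beam. -/
inductive UAVCoord where
  | x | y | z | θ | φ
  deriving DecidableEq

instance : Fintype UAVCoord :=
  ⟨{.x, .y, .z, .θ, .φ}, by intro i; cases i <;> decide⟩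

/-- The deterministic data of the link. The lens lies in the plane `x = 0`, centered at the
origin. -/
structure UAVLink where
  /-- first coordinate of the mean position of the UAV -/
  μx : ℝ
  /-- second coordinate of the mean position -/
  μy : ℝ
  /-- third coordinate of the mean position -/
  μz : ℝ
  /-- standard deviations of the fluctuations -/
  σ : UAVCoord → ℝ≥0
  /-- maximum fraction of optical power captured by the lens -/
  A₀ : ℝ
  /-- shape constant of the misalignment attenuation -/
  t : ℝ
  /-- beam width at the lens -/
  wL : ℝ
  /-- responsivity of the photodetector -/
  η : ℝ
  /-- atmospheric loss -/
  hp : ℝ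
  /-- SNR threshold -/
  γthr : ℝ

namespace UAVLink

variable (p : UAVLink)

/-- Mean azimuth of the beam: on average the beam points to the origin. -/
noncomputable def meanTheta : ℝ :=
  if 0 < p.μx then Real.pi + Real.arctan (p.μy / p.μx) else Real.arctan (p.μy / p.μx)

/-- Mean polar angle of the beam. -/
noncomputable def meanPhi : ℝ :=
  Real.pi - Real.arccos (p.μz / Real.sqrt (p.μx ^ 2 + p.μy ^ 2 + p.μz ^ 2))

noncomputable def c₁ : ℝ := -Real.tan p.meanTheta

noncomputable def c₂ : ℝ := -(p.μx / Real.cos p.meanTheta ^ 2)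

noncomputable def c₃ : ℝ := p.μx / (Real.sin p.meanPhi ^ 2 * Real.cos p.meanTheta)

noncomputable def c₄ : ℝ :=
  -(p.μx * Real.cot p.meanPhi * Real.tan p.meanTheta / Real.cos p.meanTheta)

noncomputable def c₅ : ℝ := -(Real.cot p.meanPhi / Real.cos p.meanTheta)

/-- First coordinate (`y`) of the center of the beam footprint on the lens plane, to first order
in the fluctuations `ε`. -/
noncomputable def footprintY (ε : UAVCoord → ℝ) : ℝ :=
  ε .y + p.c₁ * ε .x + p.c₂ * ε .θ

/-- Second coordinate (`z`) of the center of the beam footprint on the lens plane, to first order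
in the fluctuations `ε`. -/
noncomputable def footprintZ (ε : UAVCoord → ℝ) : ℝ :=
  ε .z + p.c₃ * ε .φ + p.c₄ * ε .θ + p.c₅ * ε .x

/-- The misalignment: distance from the center of the lens to the center of the footprint. -/
noncomputable def misalignment (ε : UAVCoord → ℝ) : ℝ :=
  Real.sqrt (p.footprintY ε ^ 2 + p.footprintZ ε ^ 2)

/-- The geometric and misalignment loss. -/
noncomputable def gml (ε : UAVCoord → ℝ) : ℝ :=
  p.A₀ * Real.exp (-(2 * p.misalignment ε ^ 2 / (p.t * p.wL ^ 2)))

/-- The received SNR, where `γ` is the transmit SNR. -/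
noncomputable def snr (γ : ℝ) (ε : UAVCoord → ℝ) : ℝ :=
  p.η ^ 2 * p.hp ^ 2 * p.gml ε ^ 2 * γ

/-- The outage probability at transmit SNR `γ`, for random fluctuations `ε` on the probability
space `(S, P)`. -/
noncomputable def outage {S : Type*} [MeasurableSpace S] (P : Measure S)
    (ε : UAVCoord → S → ℝ) (γ : ℝ) : ℝ :=
  P.real {s | p.snr γ (fun i => ε i s) ≤ p.γthr}

/-- The covariance matrix of the footprint center for independent fluctuations. -/
noncomputable def sigmaIG : Matrix (Fin 2) (Fin 2) ℝ :=
  !![(p.σ .y : ℝ) ^ 2 + p.c₁ ^ 2 * (p.σ .x : ℝ) ^ 2 + p.c₂ ^ 2 * (p.σ .θ : ℝ) ^ 2,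
     p.c₁ * p.c₅ * (p.σ .x : ℝ) ^ 2 + p.c₂ * p.c₄ * (p.σ .θ : ℝ) ^ 2;
     p.c₁ * p.c₅ * (p.σ .x : ℝ) ^ 2 + p.c₂ * p.c₄ * (p.σ .θ : ℝ) ^ 2,
     (p.σ .z : ℝ) ^ 2 + p.c₃ ^ 2 * (p.σ .φ : ℝ) ^ 2 + p.c₄ ^ 2 * (p.σ .θ : ℝ) ^ 2
       + p.c₅ ^ 2 * (p.σ .x : ℝ) ^ 2]

theorem sigmaIG_isHermitian : p.sigmaIG.IsHermitian := by
  ext i j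
  fin_cases i <;> fin_cases j <;> simp [sigmaIG]

/-- The two eigenvalues of the covariance matrix. -/
noncomputable def eig (i : Fin 2) : ℝ := p.sigmaIG_isHermitian.eigenvalues i

/-- The Hoyt (Nakagami-q) shape parameter `q`. -/
noncomputable def q : ℝ :=
  Real.sqrt (min (p.eig 0) (p.eig 1) / max (p.eig 0) (p.eig 1))

/-- The Hoyt spread parameter `Ω`. -/
noncomputable def spread : ℝ := p.eig 0 + p.eig 1

/-- The quantity `g` at transmit SNR `γ`. -/
noncomputable def g (γ : ℝ) : ℝ :=
  Real.sqrt ((1 + p.q ^ 2) / p.spread * (p.t * p.wL ^ 2 / 2)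
    * Real.log (p.η * p.hp * p.A₀ * Real.sqrt γ / Real.sqrt p.γthr))

/-- First argument `a` of the Marcum Q-function. -/
noncomputable def a (γ : ℝ) : ℝ := (1 + p.q) / (2 * p.q) * p.g γ

/-- Second argument `b` of the Marcum Q-function. -/
noncomputable def b (γ : ℝ) : ℝ := (1 - p.q) / (2 * p.q) * p.g γ

/-- The constant `b_t`. -/
noncomputable def bT : ℝ := Real.sqrt p.γthr / (p.η * p.hp * p.A₀)

/-- The constant `a_t`. -/
noncomputable def aT : ℝ :=
  2 * Real.sqrt (2 * p.spread) * p.bT ^ ((1 + p.q ^ 2) * p.t * p.wL ^ 2 / (4 * p.spread))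
    / Real.sqrt (Real.pi * (1 - p.q ^ 4) * p.t * p.wL ^ 2)

end UAVLink

/-!
In the principal axes of its covariance matrix the footprint center has independent Gaussian
coordinates, with the eigenvalues `m ≤ M` as variances (`UAVLink.real_sq_footprint_ge`), and outage
means that it leaves a disc of radius `R` with `R² = M g²` (`UAVLink.snr_le_iff`). Integrating the
density in polar coordinates, along rays first, gives the outage probability as
`hoytTail q (g²) = (1 / (π q)) ∫ v in 0..π, exp (-g² h(v) / 2) / h(v)`, where
`h(v) = 1 + (1 - q²) / (2 q²) * (1 - cos v)` and `q² = m / M`.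

The Marcum function `Q(a, b)` is the mass outside the circle of radius `b` of a standard planar
Gaussian centered at distance `a` from the origin. Away from its pole, the field
`exp (-|x|² / 2) x / |x|²` has divergence `-exp (-|x|² / 2)`. For `b < a`, the exterior of the
circle for `Q(b, a)` and the interior of the circle for `Q(a, b)` both avoid the pole, so `Q(b, a)` and
`1 - Q(a, b)` are boundary integrals (`gaussianFlux`). The squared distance to the pole along both
circles is `k(v) = a² + b² - 2ab cos v`, and the boundary integrals add up to
`(1 / π) ∫ v in 0..π, (a² - b²) / k(v) * exp (-k(v) / 2)` (`one_sub_marcumQ_add_marcumQ`). For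
`a, b = (1 ± q) g / (2 q)` one has `k = g² h` and `a² - b² = g² / q`, so this is `hoytTail q (g²)`.

For the asymptotics, Laplace's method at `v = 0` (`tendsto_mul_hoytTail`) and Mills' ratio
(`tendsto_mul_gaussQ`) show that `g exp (g² / 2)` times the outage probability and times its first
asymptotic form have the same limit, and for the second form this product is constant, because `g²`
is a multiple of `log (γ / b_t²)`. The diversity order comes from `log (hoytTail q (g²)) ~ -g² / 2`,
which also holds for `q = 1`, where the tail is exactly `exp (-g² / 2)`.
-/

/-! ### Integrals over a full turn -/

theorem integral_comp_cos_symm {f : ℝ → ℝ} (hf : Continuous fun v => f (Real.cos v)) :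
    ∫ v in (-Real.pi)..Real.pi, f (Real.cos v) = 2 * ∫ v in (0 : ℝ)..Real.pi, f (Real.cos v) := by
  rw [← intervalIntegral.integral_add_adjacent_intervals (b := 0)
    (hf.intervalIntegrable _ _) (hf.intervalIntegrable _ _)]
  have h := intervalIntegral.integral_comp_neg (a := 0) (b := Real.pi)
    (fun v => f (Real.cos v))
  simp only [Real.cos_neg, neg_zero] at h
  rw [← h]; ring

theorem integral_comp_cos_two_mul {f : ℝ → ℝ} (hf : Continuous fun v => f (Real.cos v)) :
    ∫ v in (-Real.pi)..Real.pi, f (Real.cos (2 * v))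
      = 2 * ∫ v in (0 : ℝ)..Real.pi, f (Real.cos v) := by
  have h := intervalIntegral.integral_comp_mul_left (a := -Real.pi) (b := Real.pi)
    (fun v => f (Real.cos v)) (two_ne_zero (α := ℝ))
  have hp : Function.Periodic (fun v => f (Real.cos v)) (2 * Real.pi) := fun v => by simp
  have h1 := hp.intervalIntegral_add_eq (-(2 * Real.pi)) (-Real.pi)
  have h2 := hp.intervalIntegral_add_eq 0 (-Real.pi)
  have e1 : -(2 * Real.pi) + 2 * Real.pi = 0 := by ring
  have e2 : -Real.pi + 2 * Real.pi = Real.pi := by ring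
  rw [e1, e2] at h1
  rw [zero_add, e2] at h2
  rw [h, mul_neg, ← intervalIntegral.integral_add_adjacent_intervals (b := 0)
    (hf.intervalIntegrable _ _) (hf.intervalIntegrable _ _), h1, h2, integral_comp_cos_symm hf]
  simp only [smul_eq_mul]; ring

/-! ### Differentiation under an integral over a compact interval -/

theorem hasDerivAt_intervalIntegral_of_continuousOn {F F' : ℝ → ℝ → ℝ} {U : Set ℝ}
    (hU : IsOpen U) {y a b : ℝ} (hy : y ∈ U)
    (hF : ContinuousOn (fun z : ℝ × ℝ => F z.1 z.2) (U ×ˢ Set.univ))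
    (hF' : ContinuousOn (fun z : ℝ × ℝ => F' z.1 z.2) (U ×ˢ Set.univ))
    (hd : ∀ x ∈ U, ∀ v, HasDerivAt (fun x => F x v) (F' x v) x) :
    HasDerivAt (fun x => ∫ v in a..b, F x v) (∫ v in a..b, F' y v) y := by
  obtain ⟨ε, hε, hball⟩ := Metric.nhds_basis_closedBall.mem_iff.1 (hU.mem_nhds hy)
  have hslice : ∀ {G : ℝ → ℝ → ℝ}, ContinuousOn (fun z : ℝ × ℝ => G z.1 z.2) (U ×ˢ Set.univ) →
      ∀ x ∈ U, Continuous (G x) := by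
    intro G hG x hx
    rw [← continuousOn_univ]
    exact hG.comp (f := fun v => (x, v)) (by fun_prop) fun v _ => ⟨hx, trivial⟩
  have hcomp : IsCompact (Metric.closedBall y ε ×ˢ Set.uIcc a b) :=
    (isCompact_closedBall y ε).prod isCompact_uIcc
  obtain ⟨C, hC⟩ := hcomp.exists_bound_of_continuousOn
    (hF'.mono (Set.prod_mono hball (Set.subset_univ _)))
  refine (intervalIntegral.hasDerivAt_integral_of_dominated_loc_of_deriv_le
    (s := Metric.closedBall y ε) (bound := fun _ => C) (F := F) (F' := F')
    (Metric.closedBall_mem_nhds y hε) ?_ ?_ ?_ ?_ ?_ ?_).2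
  · filter_upwards [hU.mem_nhds hy] with x hx
    exact (hslice hF x hx).aestronglyMeasurable
  · exact (hslice hF y hy).intervalIntegrable _ _
  · exact (hslice hF' y hy).aestronglyMeasurable
  · exact Eventually.of_forall fun v hv x hx => hC (x, v) ⟨hx, Set.uIoc_subset_uIcc hv⟩
  · simp
  · exact Eventually.of_forall fun v _ x hx => hd x (hball hx) v

/-! ### The Marcum Q-function as an angular integral -/

/-- Squared distance from the point with polar coordinates `(y, v)` to the point at distance `c`
from the origin on the polar axis. -/
noncomputable def sqDistPolar (c y v : ℝ) : ℝ := y ^ 2 + c ^ 2 - 2 * c * y * Real.cos v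

theorem sqDistPolar_comm (c y v : ℝ) : sqDistPolar c y v = sqDistPolar y c v := by
  unfold sqDistPolar; ring

theorem sq_sub_le_sqDistPolar {c y : ℝ} (hc : 0 ≤ c) (hy : 0 ≤ y) (v : ℝ) :
    (y - c) ^ 2 ≤ sqDistPolar c y v := by
  unfold sqDistPolar
  nlinarith [mul_nonneg (mul_nonneg hc hy) (sub_nonneg.2 (Real.cos_le_one v))]

theorem sqDistPolar_pos {c y : ℝ} (h : |c| ≠ |y|) (v : ℝ) : 0 < sqDistPolar c y v := by
  have h1 : (|y| - |c|) ^ 2 ≤ sqDistPolar c y v := by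
    have : c * y * Real.cos v ≤ |c| * |y| := by
      calc c * y * Real.cos v ≤ |c * y * Real.cos v| := le_abs_self _
        _ = |c| * |y| * |Real.cos v| := by rw [abs_mul, abs_mul]
        _ ≤ |c| * |y| * 1 := by gcongr; exact Real.abs_cos_le_one v
        _ = _ := mul_one _
    unfold sqDistPolar
    nlinarith [sq_abs c, sq_abs y]
  have : 0 < (|y| - |c|) ^ 2 := by
    have : |y| - |c| ≠ 0 := sub_ne_zero.2 h.symm
    positivity
  linarith

theorem continuous_sqDistPolar (c : ℝ) :
    Continuous fun z : ℝ × ℝ => sqDistPolar c z.1 z.2 := by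
  unfold sqDistPolar; fun_prop

theorem marcumQ_eq (c b : ℝ) :
    marcumQ c b = ∫ y in Set.Ioi b, (1 / Real.pi) *
      ∫ v in (0 : ℝ)..Real.pi, y * Real.exp (-sqDistPolar c y v / 2) := by
  unfold marcumQ besselI0
  congr 1
  ext y
  rw [mul_left_comm, ← intervalIntegral.integral_const_mul]
  congr 2
  ext v
  rw [mul_assoc, ← Real.exp_add]
  congr 2
  unfold sqDistPolar; ring

/-- The outward flux, through the upper half of the circle of radius `y` centered at the origin,
of the field `x ↦ exp (-|x|² / 2) x / |x|²` translated to the point at distance `c` on the polar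
axis. The divergence of this field is `-exp (-|x|² / 2)`. -/
noncomputable def gaussianFlux (c y : ℝ) : ℝ :=
  ∫ v in (0 : ℝ)..Real.pi,
    y * (y - c * Real.cos v) / sqDistPolar c y v * Real.exp (-sqDistPolar c y v / 2)

/-- The divergence theorem for the field of `gaussianFlux`: its angular component vanishes on the
polar axis, so only the radial component contributes. -/
theorem hasDerivAt_gaussianFlux {c y : ℝ} (hcy : |c| ≠ |y|) :
    HasDerivAt (gaussianFlux c)
      (-∫ v in (0 : ℝ)..Real.pi, y * Real.exp (-sqDistPolar c y v / 2)) y := by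
  set F' : ℝ → ℝ → ℝ := fun y v =>
    ((2 * y - c * Real.cos v) * sqDistPolar c y v
      - y * (y - c * Real.cos v) * (2 * y - 2 * c * Real.cos v)) / sqDistPolar c y v ^ 2
      * Real.exp (-sqDistPolar c y v / 2)
    + y * (y - c * Real.cos v) / sqDistPolar c y v
      * (Real.exp (-sqDistPolar c y v / 2) * (-(2 * y - 2 * c * Real.cos v) / 2)) with hF'
  set B' : ℝ → ℝ := fun v =>
    (c * Real.cos v * sqDistPolar c y v - c * Real.sin v * (2 * c * y * Real.sin v))
      / sqDistPolar c y v ^ 2 * Real.exp (-sqDistPolar c y v / 2)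
    + c * Real.sin v / sqDistPolar c y v
      * (Real.exp (-sqDistPolar c y v / 2) * (-(2 * c * y * Real.sin v) / 2)) with hB'
  have hKc := continuous_sqDistPolar c
  have hK0 : ∀ v, sqDistPolar c y v ≠ 0 := fun v => (sqDistPolar_pos hcy v).ne'
  have hU : IsOpen {x : ℝ | |c| ≠ |x|} := isOpen_ne_fun (by fun_prop) (by fun_prop)
  have hne : ∀ z ∈ {x : ℝ | |c| ≠ |x|} ×ˢ (Set.univ : Set ℝ), sqDistPolar c z.1 z.2 ≠ 0 :=
    fun z hz => (sqDistPolar_pos hz.1 z.2).ne'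
  have hne2 : ∀ z ∈ {x : ℝ | |c| ≠ |x|} ×ˢ (Set.univ : Set ℝ), sqDistPolar c z.1 z.2 ^ 2 ≠ 0 :=
    fun z hz => pow_ne_zero 2 (hne z hz)
  have hder : HasDerivAt (gaussianFlux c) (∫ v in (0 : ℝ)..Real.pi, F' y v) y := by
    refine hasDerivAt_intervalIntegral_of_continuousOn (F' := F') hU hcy ?_ ?_ ?_
    · refine ContinuousOn.mul (ContinuousOn.div ?_ hKc.continuousOn hne) ?_ <;>
      · apply Continuous.continuousOn; fun_prop
    · refine ContinuousOn.add (ContinuousOn.mul (ContinuousOn.div ?_ ?_ hne2) ?_)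
        (ContinuousOn.mul (ContinuousOn.div ?_ hKc.continuousOn hne) ?_) <;>
      · apply Continuous.continuousOn; fun_prop
    · intro x hx v
      have hK : HasDerivAt (fun x => sqDistPolar c x v) (2 * x - 2 * c * Real.cos v) x := by
        unfold sqDistPolar
        have := (((hasDerivAt_pow 2 x).add_const (c ^ 2)).sub
          (((hasDerivAt_id x).const_mul (2 * c)).mul_const (Real.cos v)))
        refine this.congr_deriv ?_
        simp
      have hN : HasDerivAt (fun x => x * (x - c * Real.cos v)) (2 * x - c * Real.cos v) x := by
        refine ((hasDerivAt_id x).mul ((hasDerivAt_id x).sub_const _)).congr_deriv ?_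
        simp; ring
      exact (hN.div hK (sqDistPolar_pos hx v).ne').mul (hK.neg.div_const 2).exp
  have hB : ∫ v in (0 : ℝ)..Real.pi, B' v = 0 := by
    have hBc : Continuous B' := by
      have h1 : Continuous fun v => sqDistPolar c y v := by unfold sqDistPolar; fun_prop
      refine Continuous.add (Continuous.mul (Continuous.div ?_ (h1.pow 2)
        fun v => pow_ne_zero 2 (hK0 v)) ?_) (Continuous.mul (Continuous.div ?_ h1 hK0) ?_) <;>
      fun_prop
    have hd : ∀ v, HasDerivAt (fun v => c * Real.sin v / sqDistPolar c y v
        * Real.exp (-sqDistPolar c y v / 2)) (B' v) v := by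
      intro v
      have hK : HasDerivAt (fun v => sqDistPolar c y v) (2 * c * y * Real.sin v) v := by
        unfold sqDistPolar
        refine (((Real.hasDerivAt_cos v).const_mul (2 * c * y)).const_sub
          (y ^ 2 + c ^ 2)).congr_deriv ?_
        ring
      exact (((Real.hasDerivAt_sin v).const_mul c).div hK (hK0 v)).mul (hK.neg.div_const 2).exp
    rw [intervalIntegral.integral_eq_sub_of_hasDerivAt (fun v _ => hd v)
      (hBc.intervalIntegrable _ _)]
    simp
  have key : ∀ v, F' y v = -(y * Real.exp (-sqDistPolar c y v / 2)) - B' v := by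
    intro v
    have hs : Real.sin v ^ 2 = 1 - Real.cos v ^ 2 := by rw [Real.sin_sq]
    have hk := hK0 v
    simp only [hF', hB']
    generalize Real.exp (-sqDistPolar c y v / 2) = E
    have hkdef : sqDistPolar c y v = y ^ 2 + c ^ 2 - 2 * c * y * Real.cos v := rfl
    generalize sqDistPolar c y v = K at *
    field_simp
    subst hkdef
    linear_combination
      -(2 + (y ^ 2 + c ^ 2 - 2 * c * y * Real.cos v)) * c ^ 2 * y * E * hs
  refine hder.congr_deriv ?_
  simp only [key]
  rw [intervalIntegral.integral_sub, hB, intervalIntegral.integral_neg, sub_zero]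
  · exact Continuous.intervalIntegrable (by unfold sqDistPolar; fun_prop) _ _
  · have h1 : Continuous fun v => sqDistPolar c y v := by unfold sqDistPolar; fun_prop
    refine Continuous.intervalIntegrable (Continuous.add (Continuous.mul (Continuous.div ?_
        (h1.pow 2) fun v => pow_ne_zero 2 (hK0 v)) ?_)
        (Continuous.mul (Continuous.div ?_ h1 hK0) ?_)) _ _ <;>
      fun_prop

theorem tendsto_gaussianFlux_atTop {c : ℝ} (hc : 0 ≤ c) :
    Tendsto (gaussianFlux c) atTop (𝓝 0) := by
  have hlim : Tendsto (fun y : ℝ => Real.pi * (2 * y / Real.exp (y - 1)))  atTop (𝓝 0) := by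
    have h1 := (Real.tendsto_pow_mul_exp_neg_atTop_nhds_zero 1).const_mul
      (Real.pi * 2 * Real.exp 1)
    rw [mul_zero] at h1
    refine h1.congr fun y => ?_
    rw [Real.exp_sub, Real.exp_neg]
    field_simp
  refine squeeze_zero_norm' (a := fun y : ℝ => Real.pi * (2 * y / Real.exp (y - 1))) ?_ hlim
  filter_upwards [eventually_ge_atTop (2 * c + 8)] with y hy
  have hy0 : 0 < y := by linarith
  have hb : ∀ v ∈ Set.uIoc (0 : ℝ) Real.pi,
      ‖y * (y - c * Real.cos v) / sqDistPolar c y v * Real.exp (-sqDistPolar c y v / 2)‖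
        ≤ 2 * y / Real.exp (y - 1) := by
    intro v _
    have h1 := sq_sub_le_sqDistPolar hc hy0.le v
    have h2 : y ^ 2 / 4 ≤ sqDistPolar c y v := by nlinarith
    have h2' : 2 * y ≤ sqDistPolar c y v := by nlinarith
    have h3 : 1 ≤ sqDistPolar c y v := by linarith
    have h4 : |y - c * Real.cos v| ≤ 2 * y := by
      have := Real.abs_cos_le_one v
      rw [abs_le] at this ⊢
      constructor <;> nlinarith
    have h5 : |y - c * Real.cos v| * y / sqDistPolar c y v ≤ 8 := by
      rw [div_le_iff₀ (by linarith)]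
      nlinarith
    have h6 : Real.exp (-sqDistPolar c y v / 2) ≤ 1 / Real.exp (y - 1) / Real.exp 1 := by
      rw [div_div, ← Real.exp_add, one_div, ← Real.exp_neg]
      apply Real.exp_le_exp.2; linarith
    have h7 : Real.exp (-sqDistPolar c y v / 2) ≤ 1 / Real.exp (y - 1) := by
      refine h6.trans (div_le_self (by positivity) (Real.one_le_exp (by norm_num)))
    rw [norm_mul, norm_div, norm_mul, Real.norm_of_nonneg hy0.le,
      Real.norm_of_nonneg (by linarith : 0 ≤ sqDistPolar c y v),
      Real.norm_of_nonneg (Real.exp_pos _).le, Real.norm_eq_abs, mul_comm y]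
    calc _ ≤ 8 * (1 / Real.exp (y - 1)) := by gcongr
      _ ≤ 2 * y / Real.exp (y - 1) := by
        rw [mul_one_div]; gcongr; linarith
  have h := intervalIntegral.norm_integral_le_of_norm_le_const hb
  rw [sub_zero, abs_of_pos Real.pi_pos] at h
  rw [mul_comm Real.pi]
  exact h

/-- The region outside a circle that encloses the pole of the field of `gaussianFlux`. -/
theorem marcumQ_eq_gaussianFlux {b a : ℝ} (hb : 0 ≤ b) (hab : b < a) :
    marcumQ b a = (1 / Real.pi) * gaussianFlux b a := by
  rw [marcumQ_eq, integral_const_mul]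
  have hne : ∀ x ∈ Set.Ici a, |b| ≠ |x| := fun x hx => by
    have : b < x := hab.trans_le hx
    rw [abs_of_nonneg hb, abs_of_nonneg (hb.trans this.le)]; exact this.ne
  have h := integral_Ioi_of_hasDerivAt_of_nonpos' (a := a) (g := gaussianFlux b) (l := 0)
    (fun x hx => hasDerivAt_gaussianFlux (hne x hx)) ?_ (tendsto_gaussianFlux_atTop hb)
  · rw [integral_neg] at h
    congr 1; linarith
  · intro x hx
    have : 0 ≤ x := hb.trans (hab.trans hx).le
    rw [neg_nonpos]
    exact intervalIntegral.integral_nonneg Real.pi_pos.le fun v _ => by positivity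

/-! ### Polar coordinates -/

theorem integrableOn_polar {F : ℝ × ℝ → ℝ} (hF : Integrable F) :
    IntegrableOn (fun p : ℝ × ℝ => p.1 * F (p.1 * Real.cos p.2, p.1 * Real.sin p.2))
      (Set.Ioi 0 ×ˢ Set.Ioo (-Real.pi) Real.pi) := by
  have hms : MeasurableSet polarCoord.target := polarCoord.open_target.measurableSet
  have h := (integrableOn_image_iff_integrableOn_abs_det_fderiv_smul volume hms
    (fun p _ => (hasFDerivAt_polarCoord_symm p).hasFDerivWithinAt) polarCoord.symm.injOn F).1
    hF.integrableOn
  refine (integrableOn_congr_fun ?_ hms).1 h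
  intro p hp
  have hp0 : 0 < p.1 := hp.1
  simp only [det_fderivPolarCoordSymm, abs_of_pos hp0, smul_eq_mul, polarCoord_symm_apply]

theorem integral_eq_polar {F : ℝ × ℝ → ℝ} :
    ∫ p, F p = ∫ p in Set.Ioi 0 ×ˢ Set.Ioo (-Real.pi) Real.pi,
      p.1 * F (p.1 * Real.cos p.2, p.1 * Real.sin p.2) :=
  (integral_comp_polarCoord_symm F).symm

theorem integral_eq_radial_integral {F : ℝ × ℝ → ℝ} (hF : Integrable F) :
    ∫ p, F p = ∫ r in Set.Ioi 0, ∫ θ in Set.Ioo (-Real.pi) Real.pi,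
      r * F (r * Real.cos θ, r * Real.sin θ) := by
  rw [integral_eq_polar, Measure.volume_eq_prod, setIntegral_prod _ (integrableOn_polar hF)]

theorem integral_eq_angular_integral {F : ℝ × ℝ → ℝ} (hF : Integrable F) :
    ∫ p, F p = ∫ θ in Set.Ioo (-Real.pi) Real.pi, ∫ r in Set.Ioi 0,
      r * F (r * Real.cos θ, r * Real.sin θ) := by
  have h := integrableOn_polar hF
  rw [IntegrableOn, Measure.volume_eq_prod, ← Measure.prod_restrict] at h
  rw [integral_eq_polar, Measure.volume_eq_prod, ← Measure.prod_restrict, integral_prod_symm _ h]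

/-! ### Normalization of the Marcum Q-function -/

theorem integral_half_gaussian : ∫ x : ℝ, Real.exp (-x ^ 2 / 2) = Real.sqrt (2 * Real.pi) := by
  have h := integral_gaussian (1 / 2)
  rw [show Real.pi / (1 / 2) = 2 * Real.pi by ring] at h
  rw [← h]; congr 1; ext x; congr 1; ring

theorem integrable_half_gaussian : Integrable fun x : ℝ => Real.exp (-x ^ 2 / 2) := by
  have h := integrable_exp_neg_mul_sq (b := 1 / 2) (by norm_num)
  refine h.congr (Eventually.of_forall fun x => ?_)
  show Real.exp _ = Real.exp _
  congr 1; ring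

/-- A planar standard Gaussian density, centered at distance `c` from the origin, has mass one. -/
theorem marcumQ_zero_right (c : ℝ) : marcumQ c 0 = 1 := by
  set F : ℝ × ℝ → ℝ := fun z => Real.exp (-(z.1 - c) ^ 2 / 2) * Real.exp (-z.2 ^ 2 / 2) with hFdef
  have hF : Integrable F := (integrable_half_gaussian.comp_sub_right c).mul_prod
    integrable_half_gaussian
  have h1 : ∫ z, F z = 2 * Real.pi := by
    rw [Measure.volume_eq_prod, integral_prod_mul (fun x => Real.exp (-(x - c) ^ 2 / 2))
      fun y => Real.exp (-y ^ 2 / 2),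
      integral_sub_right_eq_self (fun x => Real.exp (-x ^ 2 / 2)), integral_half_gaussian,
      Real.mul_self_sqrt (by positivity)]
  have hpt : ∀ r θ, F (r * Real.cos θ, r * Real.sin θ) = Real.exp (-sqDistPolar c r θ / 2) := by
    intro r θ
    simp only [hFdef]
    rw [← Real.exp_add]
    congr 1
    unfold sqDistPolar
    linear_combination (-r ^ 2 / 2) * Real.sin_sq_add_cos_sq θ
  rw [integral_eq_radial_integral hF] at h1
  rw [marcumQ_eq, integral_const_mul]
  have h2 : ∀ r : ℝ, ∫ θ in Set.Ioo (-Real.pi) Real.pi, r * F (r * Real.cos θ, r * Real.sin θ)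
      = 2 * ∫ v in (0 : ℝ)..Real.pi, r * Real.exp (-sqDistPolar c r v / 2) := by
    intro r
    simp only [hpt]
    rw [← integral_Ioc_eq_integral_Ioo,
      ← intervalIntegral.integral_of_le (by linarith [Real.pi_pos])]
    exact integral_comp_cos_symm (f := fun x =>
      r * Real.exp (-(r ^ 2 + c ^ 2 - 2 * c * r * x) / 2)) (by fun_prop)
  simp only [h2] at h1
  rw [integral_const_mul] at h1
  have : ∫ r in Set.Ioi (0 : ℝ), ∫ v in (0 : ℝ)..Real.pi,
      r * Real.exp (-sqDistPolar c r v / 2) = Real.pi := by linarith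
  rw [this]
  exact one_div_mul_cancel Real.pi_ne_zero

/-- The region inside a circle that does not enclose the pole of the field of `gaussianFlux`. -/
theorem one_sub_marcumQ_eq_gaussianFlux {a b : ℝ} (hb : 0 ≤ b) (hab : b < a) :
    1 - marcumQ a b = -((1 / Real.pi) * gaussianFlux a b) := by
  set D : ℝ → ℝ := fun y => ∫ v in (0 : ℝ)..Real.pi, y * Real.exp (-sqDistPolar a y v / 2)
    with hD
  have h1 : (1 / Real.pi) * ∫ y in Set.Ioi 0, D y = 1 := by
    rw [← integral_const_mul, ← marcumQ_eq, marcumQ_zero_right]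
  -- the Bochner integral of a non-integrable function vanishes, so mass one gives integrability
  have hint : IntegrableOn D (Set.Ioi 0) := by
    by_contra h
    rw [integral_undef h] at h1
    simp at h1
  have hsplit : ∫ y in Set.Ioi 0, D y = (∫ y in (0 : ℝ)..b, D y) + ∫ y in Set.Ioi b, D y := by
    rw [intervalIntegral.integral_of_le hb, ← setIntegral_union
      (Set.Ioc_disjoint_Ioi le_rfl) measurableSet_Ioi
      (hint.mono_set Set.Ioc_subset_Ioi_self) (hint.mono_set (Set.Ioi_subset_Ioi hb)),
      Set.Ioc_union_Ioi_eq_Ioi hb]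
  have hne : ∀ y ∈ Set.uIcc 0 b, |a| ≠ |y| := fun y hy => by
    rw [Set.uIcc_of_le hb] at hy
    rw [abs_of_nonneg hy.1, abs_of_nonneg (hb.trans hab.le)]
    exact (hy.2.trans_lt hab).ne'
  have hii : IntervalIntegrable D volume 0 b :=
    (intervalIntegrable_iff_integrableOn_Ioc_of_le hb).2 (hint.mono_set Set.Ioc_subset_Ioi_self)
  have hftc := intervalIntegral.integral_eq_sub_of_hasDerivAt
    (fun y hy => hasDerivAt_gaussianFlux (hne y hy)) hii.neg
  have h0 : gaussianFlux a 0 = 0 := by simp [gaussianFlux]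
  rw [h0, intervalIntegral.integral_neg, sub_zero] at hftc
  rw [marcumQ_eq, integral_const_mul, ← hftc]
  rw [hsplit] at h1
  linear_combination -h1

/-- `sqDistPolar` is symmetric in the two radii, so the two flux integrals share their denominator
and exponent, and combine into a single angular integral. -/
theorem one_sub_marcumQ_add_marcumQ {a b : ℝ} (hb : 0 ≤ b) (hab : b < a) :
    1 - marcumQ a b + marcumQ b a = (1 / Real.pi) * ∫ v in (0 : ℝ)..Real.pi,
      (a ^ 2 - b ^ 2) / sqDistPolar a b v * Real.exp (-sqDistPolar a b v / 2) := by
  have hpos : ∀ v, sqDistPolar a b v ≠ 0 := fun v => (sqDistPolar_pos (by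
    rw [abs_of_nonneg hb, abs_of_nonneg (hb.trans hab.le)]; exact hab.ne') v).ne'
  have hc : Continuous fun v => sqDistPolar a b v := by unfold sqDistPolar; fun_prop
  rw [one_sub_marcumQ_eq_gaussianFlux hb hab, marcumQ_eq_gaussianFlux hb hab, neg_add_eq_sub,
    ← mul_sub, gaussianFlux, gaussianFlux, ← intervalIntegral.integral_sub]
  · congr 2
    ext v
    rw [sqDistPolar_comm b a, ← sub_mul, ← sub_div]
    ring
  · simp only [sqDistPolar_comm b a]
    exact ((Continuous.div (by fun_prop) hc hpos).mul (by fun_prop)).intervalIntegrable _ _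
  · exact ((Continuous.div (by fun_prop) hc hpos).mul (by fun_prop)).intervalIntegrable _ _

/-! ### Tail of the radius of a planar Gaussian vector -/

theorem integral_Ici_mul_exp {ρ h : ℝ} (hρ : 0 ≤ ρ) (hh : 0 < h) :
    ∫ r in Set.Ioi (0 : ℝ), r * (Set.Ici (Real.sqrt ρ)).indicator
      (fun r => Real.exp (-(h * r ^ 2) / 2)) r = Real.exp (-(ρ * h) / 2) / h := by
  have e : (fun r : ℝ => r * (Set.Ici (Real.sqrt ρ)).indicator
      (fun r => Real.exp (-(h * r ^ 2) / 2)) r)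
      = (Set.Ici (Real.sqrt ρ)).indicator fun r => r * Real.exp (-(h * r ^ 2) / 2) := by
    ext r; simp only [Set.indicator_apply]; split_ifs <;> simp
  rw [e, ← integral_Ici_eq_integral_Ioi, setIntegral_indicator measurableSet_Ici,
    Set.inter_eq_self_of_subset_right (Set.Ici_subset_Ici.2 (Real.sqrt_nonneg ρ)),
    integral_Ici_eq_integral_Ioi]
  have hd : ∀ r ∈ Set.Ici (Real.sqrt ρ), HasDerivAt (fun r => -Real.exp (-(h * r ^ 2) / 2) / h)
      (r * Real.exp (-(h * r ^ 2) / 2)) r := by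
    intro r _
    have := (((((hasDerivAt_pow 2 r).const_mul h).neg.div_const 2).exp).neg.div_const h)
    refine this.congr_deriv ?_
    simp only [Pi.neg_apply]
    field_simp
    simp [mul_comm]
  have hlim : Tendsto (fun r : ℝ => -Real.exp (-(h * r ^ 2) / 2) / h) atTop (𝓝 0) := by
    have h1 : Tendsto (fun r : ℝ => h / 2 * r ^ 2) atTop atTop :=
      (tendsto_pow_atTop two_ne_zero).const_mul_atTop (by positivity)
    have h2 := ((Real.tendsto_exp_neg_atTop_nhds_zero.comp h1).neg.div_const h)
    rw [neg_zero, zero_div] at h2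
    refine h2.congr fun r => ?_
    simp only [Function.comp]
    congr 3; ring
  rw [integral_Ioi_of_hasDerivAt_of_nonneg' hd (fun r hr => ?_) hlim]
  · rw [Real.sq_sqrt hρ, mul_comm h ρ]; ring
  · have : 0 ≤ r := (Real.sqrt_nonneg ρ).trans (le_of_lt hr)
    positivity

/-- Tail probability of the squared radius of a planar Gaussian vector with independent centered
coordinates: the density is integrated along rays first. -/
theorem gaussianReal_prod_radius_tail {v₀ v₁ : ℝ≥0} (h₀ : v₀ ≠ 0) (h₁ : v₁ ≠ 0) {ρ : ℝ}
    (hρ : 0 ≤ ρ) :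
    ((gaussianReal 0 v₀).prod (gaussianReal 0 v₁)).real {z | ρ ≤ z.1 ^ 2 + z.2 ^ 2}
      = 1 / (2 * Real.pi * Real.sqrt (v₀ * v₁)) * ∫ θ in (-Real.pi)..Real.pi,
        Real.exp (-(ρ * (Real.cos θ ^ 2 / v₀ + Real.sin θ ^ 2 / v₁)) / 2)
          / (Real.cos θ ^ 2 / v₀ + Real.sin θ ^ 2 / v₁) := by
  have p₀ : (0 : ℝ) < v₀ := NNReal.coe_pos.2 (pos_iff_ne_zero.2 h₀)
  have p₁ : (0 : ℝ) < v₁ := NNReal.coe_pos.2 (pos_iff_ne_zero.2 h₁)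
  set T : Set (ℝ × ℝ) := {z | ρ ≤ z.1 ^ 2 + z.2 ^ 2} with hT
  have hTm : MeasurableSet T := measurableSet_le measurable_const (by fun_prop)
  set F : ℝ × ℝ → ℝ := T.indicator fun z => gaussianPDFReal 0 v₀ z.1 * gaussianPDFReal 0 v₁ z.2
    with hFdef
  have hF : Integrable F := ((integrable_gaussianPDFReal 0 v₀).mul_prod
    (integrable_gaussianPDFReal 0 v₁)).indicator hTm
  have h1 : ((gaussianReal 0 v₀).prod (gaussianReal 0 v₁)).real T = ∫ z, F z := by
    rw [← integral_indicator_one hTm, integral_prod _ ((integrable_const 1).indicator hTm),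
      integral_gaussianReal_eq_integral_smul h₀, Measure.volume_eq_prod, integral_prod _ hF]
    congr 1
    ext x
    rw [integral_gaussianReal_eq_integral_smul h₁, ← integral_smul]
    congr 1
    ext y
    simp only [hFdef, Set.indicator_apply, smul_eq_mul]
    split_ifs <;> simp
  rw [h1, integral_eq_angular_integral hF, ← integral_Ioc_eq_integral_Ioo,
    ← intervalIntegral.integral_of_le (by linarith [Real.pi_pos]),
    ← intervalIntegral.integral_const_mul]
  congr 1
  ext θ
  set h := Real.cos θ ^ 2 / v₀ + Real.sin θ ^ 2 / v₁ with hh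
  have hpos : 0 < h := by
    rcases eq_or_ne (Real.cos θ) 0 with hc | hc
    · have hs : Real.sin θ ^ 2 = 1 := by
        have := Real.sin_sq_add_cos_sq θ
        rw [hc] at this; linarith
      rw [hh, hs, hc]; simp [p₁]
    · positivity
  rw [← integral_Ici_mul_exp hρ hpos, ← integral_const_mul]
  refine setIntegral_congr_fun measurableSet_Ioi fun r hr => ?_
  have hr0 : (0 : ℝ) < r := hr
  have hmem : (r * Real.cos θ, r * Real.sin θ) ∈ T ↔ r ∈ Set.Ici (Real.sqrt ρ) := by
    have e : (r * Real.cos θ) ^ 2 + (r * Real.sin θ) ^ 2 = r ^ 2 := by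
      linear_combination r ^ 2 * Real.sin_sq_add_cos_sq θ
    change ρ ≤ (r * Real.cos θ) ^ 2 + (r * Real.sin θ) ^ 2 ↔ Real.sqrt ρ ≤ r
    rw [e, Real.sqrt_le_left hr0.le]
  simp only [hFdef, Set.indicator_apply, hmem]
  split_ifs with hmem'
  · simp only [gaussianPDFReal, sub_zero]
    rw [mul_mul_mul_comm, ← Real.exp_add, ← mul_inv, ← Real.sqrt_mul (by positivity),
      show 2 * Real.pi * (v₀ : ℝ) * (2 * Real.pi * v₁) = (2 * Real.pi) ^ 2 * (v₀ * v₁) by ring,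
      Real.sqrt_mul (by positivity), Real.sqrt_sq (by positivity), one_div, hh]
    rw [show -(r * Real.cos θ) ^ 2 / (2 * (v₀ : ℝ)) + -(r * Real.sin θ) ^ 2 / (2 * v₁)
      = -((Real.cos θ ^ 2 / v₀ + Real.sin θ ^ 2 / v₁) * r ^ 2) / 2 by field_simp; ring]
    ring
  · simp

/-! ### The Hoyt tail function -/

/-- The exponent `1 + κ (1 - cos v)`, with `κ = (1 - q²) / (2 q²)`, in the angular form of the Hoyt
tail; it ranges from `1` (at `v = 0`) to `1 / q²` (at `v = π`). -/
noncomputable def hoytExponent (q v : ℝ) : ℝ := 1 + (1 - q ^ 2) / (2 * q ^ 2) * (1 - Real.cos v)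

/-- Angular form of the probability that `X² + q² Y²` is at least `x`, for independent standard
Gaussian variables `X` and `Y`. -/
noncomputable def hoytTail (q x : ℝ) : ℝ :=
  1 / (Real.pi * q) * ∫ v in (0 : ℝ)..Real.pi,
    Real.exp (-(x * hoytExponent q v) / 2) / hoytExponent q v

theorem one_le_hoytExponent {q : ℝ} (hq : 0 < q) (hq1 : q ≤ 1) (v : ℝ) :
    1 ≤ hoytExponent q v := by
  have h1 : 0 ≤ 1 - q ^ 2 := by nlinarith
  have h2 : 0 ≤ 1 - Real.cos v := sub_nonneg.2 (Real.cos_le_one v)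
  have : 0 ≤ (1 - q ^ 2) / (2 * q ^ 2) * (1 - Real.cos v) := by positivity
  unfold hoytExponent; linarith

theorem continuous_hoytExponent (q : ℝ) : Continuous (hoytExponent q) := by
  unfold hoytExponent; fun_prop

theorem hoytTail_one (x : ℝ) : hoytTail 1 x = Real.exp (-x / 2) := by
  have : ∀ v, hoytExponent 1 v = 1 := fun v => by simp [hoytExponent]
  simp only [hoytTail, this, mul_one, div_one, intervalIntegral.integral_const, sub_zero,
    smul_eq_mul]
  rw [← mul_assoc, one_div_mul_cancel Real.pi_ne_zero, one_mul]

theorem integral_hoyt_cos {q M : ℝ} (hq : 0 < q) (hq1 : q ≤ 1) (x : ℝ) :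
    ∫ θ in (-Real.pi)..Real.pi,
      Real.exp (-(x * hoytExponent q (2 * θ)) / 2) / (hoytExponent q (2 * θ) / M)
    = 2 * M * ∫ v in (0 : ℝ)..Real.pi,
      Real.exp (-(x * hoytExponent q v) / 2) / hoytExponent q v := by
  set f : ℝ → ℝ := fun y => M * (Real.exp (-(x * (1 + (1 - q ^ 2) / (2 * q ^ 2) * (1 - y))) / 2)
    / (1 + (1 - q ^ 2) / (2 * q ^ 2) * (1 - y))) with hf
  have hfv : ∀ v, f (Real.cos v)
      = M * (Real.exp (-(x * hoytExponent q v) / 2) / hoytExponent q v) := fun v => rfl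
  have hc : Continuous fun v => f (Real.cos v) := by
    simp only [hfv]
    have := continuous_hoytExponent q
    exact continuous_const.mul (Continuous.div (by fun_prop) this
      fun v => (zero_lt_one.trans_le (one_le_hoytExponent hq hq1 v)).ne')
  have h := integral_comp_cos_two_mul hc
  simp only [hfv] at h
  rw [intervalIntegral.integral_const_mul, intervalIntegral.integral_const_mul, ← mul_assoc] at h
  rw [← h, ← intervalIntegral.integral_const_mul]
  congr 1
  ext θ
  rw [div_div_eq_mul_div]; ring

theorem integral_hoyt_neg_cos {q M : ℝ} (hq : 0 < q) (hq1 : q ≤ 1) (x : ℝ) :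
    ∫ θ in (-Real.pi)..Real.pi,
      Real.exp (-(x * hoytExponent q (2 * θ + Real.pi)) / 2)
        / (hoytExponent q (2 * θ + Real.pi) / M)
    = 2 * M * ∫ v in (0 : ℝ)..Real.pi,
      Real.exp (-(x * hoytExponent q v) / 2) / hoytExponent q v := by
  have hp : Function.Periodic (fun θ => Real.exp (-(x * hoytExponent q (2 * θ)) / 2)
      / (hoytExponent q (2 * θ) / M)) (2 * Real.pi) := by
    intro θ
    have : hoytExponent q (2 * (θ + 2 * Real.pi)) = hoytExponent q (2 * θ) := by
      unfold hoytExponent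
      rw [show 2 * (θ + 2 * Real.pi) = 2 * θ + 2 * Real.pi + 2 * Real.pi by ring,
        Real.cos_add_two_pi, Real.cos_add_two_pi]
    simp only [this]
  have h1 := intervalIntegral.integral_comp_add_right (a := -Real.pi) (b := Real.pi)
    (fun θ => Real.exp (-(x * hoytExponent q (2 * θ)) / 2) / (hoytExponent q (2 * θ) / M))
    (Real.pi / 2)
  have h2 := hp.intervalIntegral_add_eq (-Real.pi + Real.pi / 2) (-Real.pi)
  rw [show -Real.pi + Real.pi / 2 + 2 * Real.pi = Real.pi + Real.pi / 2 by ring,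
    show -Real.pi + 2 * Real.pi = Real.pi by ring] at h2
  rw [← integral_hoyt_cos hq hq1, ← h2, ← h1]
  congr 1
  ext θ
  rw [show 2 * (θ + Real.pi / 2) = 2 * θ + Real.pi by ring]

/-- The angle is shifted by a quarter turn when the first variance is the smaller one. -/
theorem gaussianReal_prod_radius_tail_eq_hoytTail {v₀ v₁ : ℝ≥0} (h₀ : v₀ ≠ 0) (h₁ : v₁ ≠ 0)
    {ρ : ℝ} (hρ : 0 ≤ ρ) :
    ((gaussianReal 0 v₀).prod (gaussianReal 0 v₁)).real {z | ρ ≤ z.1 ^ 2 + z.2 ^ 2}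
      = hoytTail (Real.sqrt (min (v₀ : ℝ) v₁ / max (v₀ : ℝ) v₁)) (ρ / max (v₀ : ℝ) v₁) := by
  have p₀ : (0 : ℝ) < v₀ := NNReal.coe_pos.2 (pos_iff_ne_zero.2 h₀)
  have p₁ : (0 : ℝ) < v₁ := NNReal.coe_pos.2 (pos_iff_ne_zero.2 h₁)
  rw [gaussianReal_prod_radius_tail h₀ h₁ hρ]
  set m := min (v₀ : ℝ) v₁ with hm
  set M := max (v₀ : ℝ) v₁ with hM
  have pm : 0 < m := lt_min p₀ p₁
  have pM : 0 < M := lt_max_of_lt_left p₀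
  have hmM : m ≤ M := min_le_max
  have hprod : (v₀ : ℝ) * v₁ = m * M := (min_mul_max _ _).symm
  set q := Real.sqrt (m / M) with hqdef
  have hq : 0 < q := Real.sqrt_pos.2 (by positivity)
  have hqsq : q ^ 2 = m / M := Real.sq_sqrt (by positivity)
  have hq1 : q ≤ 1 := Real.sqrt_le_one.2 ((div_le_one pM).2 hmM)
  have hsqrt : Real.sqrt (v₀ * v₁) = q * M := by
    rw [hprod, Real.sqrt_eq_iff_mul_self_eq (by positivity) (by positivity)]
    have : q ^ 2 * M = m := by rw [hqsq]; field_simp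
    linear_combination -M * this
  have hκ : (1 - q ^ 2) / (2 * q ^ 2) = (M / m - 1) / 2 := by
    rw [hqsq]; field_simp
  have hint : ∫ θ in (-Real.pi)..Real.pi,
        Real.exp (-(ρ * (Real.cos θ ^ 2 / v₀ + Real.sin θ ^ 2 / v₁)) / 2)
          / (Real.cos θ ^ 2 / v₀ + Real.sin θ ^ 2 / v₁)
      = 2 * M * ∫ v in (0 : ℝ)..Real.pi,
        Real.exp (-(ρ / M * hoytExponent q v) / 2) / hoytExponent q v := by
    rcases le_total (v₁ : ℝ) v₀ with hle | hle
    · rw [← integral_hoyt_cos hq hq1]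
      have hmv : m = v₁ := min_eq_right hle
      have hMv : M = v₀ := max_eq_left hle
      have e : ∀ θ, Real.cos θ ^ 2 / v₀ + Real.sin θ ^ 2 / v₁ = hoytExponent q (2 * θ) / M := by
        intro θ
        rw [hoytExponent, hκ, hmv, hMv, Real.cos_two_mul, Real.sin_sq]
        field_simp
        ring
      congr 1; ext θ
      rw [e, div_mul_eq_mul_div, mul_div_assoc]
    · rw [← integral_hoyt_neg_cos hq hq1]
      have hmv : m = v₀ := min_eq_left hle
      have hMv : M = v₁ := max_eq_right hle
      have e : ∀ θ, Real.cos θ ^ 2 / v₀ + Real.sin θ ^ 2 / v₁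
          = hoytExponent q (2 * θ + Real.pi) / M := by
        intro θ
        rw [hoytExponent, hκ, hmv, hMv, Real.cos_add_pi, Real.cos_two_mul, Real.sin_sq]
        field_simp
        ring
      congr 1; ext θ
      rw [e, div_mul_eq_mul_div, mul_div_assoc]
  rw [hint, hsqrt, hoytTail]
  field_simp

theorem hoytTail_zero {q : ℝ} (hq : 0 < q) (hq1 : q ≤ 1) : hoytTail q 0 = 1 := by
  have hv : q.toNNReal ^ 2 ≠ 0 := pow_ne_zero 2 (Real.toNNReal_pos.2 hq).ne'
  have h := gaussianReal_prod_radius_tail_eq_hoytTail (v₀ := 1) one_ne_zero hv le_rfl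
  have e : {z : ℝ × ℝ | 0 ≤ z.1 ^ 2 + z.2 ^ 2} = Set.univ :=
    Set.eq_univ_of_forall fun z => by
      change 0 ≤ z.1 ^ 2 + z.2 ^ 2; positivity
  have hq2 : q ^ 2 ≤ 1 := by nlinarith
  rw [e, probReal_univ] at h
  simp only [NNReal.coe_one, NNReal.coe_pow, Real.coe_toNNReal q hq.le,
    min_eq_right hq2, max_eq_left hq2, div_one,
    Real.sqrt_sq hq.le] at h
  exact h.symm

/-- The complementary Hoyt distribution function in terms of Marcum Q-functions. -/
theorem one_sub_marcumQ_add_marcumQ_eq_hoytTail {q g : ℝ} (hq : 0 < q) (hq1 : q ≤ 1)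
    (hg : 0 ≤ g) :
    1 - marcumQ ((1 + q) / (2 * q) * g) ((1 - q) / (2 * q) * g)
      + marcumQ ((1 - q) / (2 * q) * g) ((1 + q) / (2 * q) * g) = hoytTail q (g ^ 2) := by
  rcases hg.eq_or_lt with rfl | hg
  · simp [marcumQ_zero_right, hoytTail_zero hq hq1]
  have hb : 0 ≤ (1 - q) / (2 * q) * g := by
    have : 0 ≤ 1 - q := by linarith
    positivity
  have hab : (1 - q) / (2 * q) * g < (1 + q) / (2 * q) * g := by
    gcongr; linarith
  rw [one_sub_marcumQ_add_marcumQ hb hab, hoytTail,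
    show 1 / (Real.pi * q) = 1 / Real.pi * (1 / q) by field_simp, mul_assoc,
    ← intervalIntegral.integral_const_mul (1 / q)]
  congr 1
  refine intervalIntegral.integral_congr fun v _ => ?_
  have hk : sqDistPolar ((1 + q) / (2 * q) * g) ((1 - q) / (2 * q) * g) v
      = g ^ 2 * hoytExponent q v := by
    unfold sqDistPolar hoytExponent; field_simp; ring
  have hpos := zero_lt_one.trans_le (one_le_hoytExponent hq hq1 v)
  rw [hk]
  have : ((1 + q) / (2 * q) * g) ^ 2 - ((1 - q) / (2 * q) * g) ^ 2 = g ^ 2 / q := by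
    field_simp; ring
  rw [this]
  field_simp

/-! ### Asymptotics of the Hoyt tail and of the Gaussian Q-function -/

/-- Laplace's method: after the substitution `v = w / g` the integrand is dominated by a Gaussian
function, because `1 - cos` is bounded below by a multiple of the square on `[0, π]`. -/
theorem tendsto_mul_hoytTail {q : ℝ} (hq : 0 < q) (hq1 : q < 1) :
    Tendsto (fun g : ℝ => g * Real.exp (g ^ 2 / 2) * hoytTail q (g ^ 2)) atTop
      (𝓝 (2 / Real.sqrt (1 - q ^ 2) * (1 / Real.sqrt (2 * Real.pi)))) := by
  have hπ := Real.pi_pos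
  set κ := (1 - q ^ 2) / (2 * q ^ 2) with hκdef
  have h1q : 0 < 1 - q ^ 2 := by nlinarith
  have hκ : 0 < κ := by positivity
  set Φ : ℝ → ℝ → ℝ := fun g w => (Set.Ioc 0 (g * Real.pi)).indicator
    (fun w => Real.exp (-(g ^ 2 * (κ * (1 - Real.cos (w / g)))) / 2)
      / hoytExponent q (w / g)) w with hΦ
  have hrew : ∀ᶠ g : ℝ in atTop, 1 / (Real.pi * q) * ∫ w in Set.Ioi (0 : ℝ), Φ g w
      = g * Real.exp (g ^ 2 / 2) * hoytTail q (g ^ 2) := by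
    filter_upwards [eventually_gt_atTop 0] with g hg
    rw [setIntegral_indicator measurableSet_Ioc,
      Set.inter_eq_self_of_subset_right Set.Ioc_subset_Ioi_self,
      ← intervalIntegral.integral_of_le (by positivity)]
    have h := intervalIntegral.integral_comp_div (a := 0) (b := g * Real.pi)
      (fun v => Real.exp (-(g ^ 2 * (κ * (1 - Real.cos v))) / 2) / hoytExponent q v) hg.ne'
    have h2 : ∫ v in (0 : ℝ)..Real.pi,
        Real.exp (-(g ^ 2 * (κ * (1 - Real.cos v))) / 2) / hoytExponent q v
        = Real.exp (g ^ 2 / 2) * ∫ v in (0 : ℝ)..Real.pi,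
          Real.exp (-(g ^ 2 * hoytExponent q v) / 2) / hoytExponent q v := by
      rw [← intervalIntegral.integral_const_mul]
      refine intervalIntegral.integral_congr fun v _ => ?_
      rw [← mul_div_assoc, ← Real.exp_add]
      congr 2
      rw [hoytExponent]; ring
    rw [h, zero_div, mul_div_cancel_left₀ _ hg.ne', h2, hoytTail, smul_eq_mul]
    ring
  have hdom : ∀ g : ℝ, 0 < g → ∀ w ∈ Set.Ioi (0 : ℝ),
      ‖Φ g w‖ ≤ Real.exp (-(κ / Real.pi ^ 2) * w ^ 2) := by
    intro g hg w hw
    simp only [hΦ, Set.indicator_apply]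
    split_ifs with h
    · have hw0 : 0 ≤ w / g := div_nonneg hw.le hg.le
      have hwπ : w / g ≤ Real.pi := by rw [div_le_iff₀' hg]; exact h.2
      have hcos := Real.cos_le_one_sub_mul_cos_sq (abs_le.2 ⟨by linarith, hwπ⟩)
      have h1 := one_le_hoytExponent hq hq1.le (w / g)
      rw [Real.norm_of_nonneg (by positivity)]
      refine (div_le_self (Real.exp_pos _).le h1).trans (Real.exp_le_exp.2 ?_)
      have h2 : g ^ 2 * (2 / Real.pi ^ 2 * (w / g) ^ 2) ≤ g ^ 2 * (1 - Real.cos (w / g)) := by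
        gcongr; linarith
      have h3 : g ^ 2 * (2 / Real.pi ^ 2 * (w / g) ^ 2) = 2 / Real.pi ^ 2 * w ^ 2 := by
        field_simp
      rw [h3] at h2
      have h4 := mul_le_mul_of_nonneg_left h2 hκ.le
      have h5 : κ * (2 / Real.pi ^ 2 * w ^ 2) = 2 * (κ / Real.pi ^ 2 * w ^ 2) := by ring
      linarith
    · simpa using (Real.exp_pos _).le
  -- pointwise limit: `g² (1 - cos (w / g)) → w² / 2`
  have hptw : ∀ w ∈ Set.Ioi (0 : ℝ),
      Tendsto (fun g => Φ g w) atTop (𝓝 (Real.exp (-(κ / 4) * w ^ 2))) := by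
    intro w hw
    have hw0 : 0 < w := hw
    have hwg : Tendsto (fun g : ℝ => w / g) atTop (𝓝 0) := tendsto_const_nhds.div_atTop tendsto_id
    have hcos : Tendsto (fun g : ℝ => g ^ 2 * (1 - Real.cos (w / g))) atTop (𝓝 (w ^ 2 / 2)) := by
      have hs : Tendsto (fun x => Real.sinc x) (𝓝 0) (𝓝 1) := by
        have := Real.continuous_sinc.tendsto 0
        rwa [Real.sinc_zero] at this
      have hwg2 : Tendsto (fun g : ℝ => w / g / 2) atTop (𝓝 0) := by simpa using hwg.div_const 2
      have h := ((hs.comp hwg2).pow 2).const_mul (w ^ 2 / 2)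
      rw [one_pow, mul_one] at h
      refine h.congr' ?_
      filter_upwards [eventually_gt_atTop 0] with g hg
      have hne : w / g / 2 ≠ 0 := by positivity
      simp only [Function.comp]
      rw [Real.sinc_of_ne_zero hne]
      have hc := Real.cos_sq' (w / g / 2)
      have hc2 := Real.cos_two_mul (w / g / 2)
      rw [mul_div_cancel₀ _ (two_ne_zero' ℝ)] at hc2
      rw [hc2, hc]
      field_simp
      ring
    have hden : Tendsto (fun g : ℝ => hoytExponent q (w / g)) atTop (𝓝 1) := by
      have h := ((continuous_hoytExponent q).tendsto 0).comp hwg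
      have h0 : hoytExponent q 0 = 1 := by simp [hoytExponent]
      rwa [h0] at h
    have hnum : Tendsto (fun g : ℝ =>
        Real.exp (-(g ^ 2 * (κ * (1 - Real.cos (w / g)))) / 2)) atTop
        (𝓝 (Real.exp (-(κ / 4) * w ^ 2))) := by
      refine (Real.continuous_exp.tendsto _).comp ?_
      have h := hcos.const_mul (-(κ / 2))
      rw [show -(κ / 2) * (w ^ 2 / 2) = -(κ / 4) * w ^ 2 by ring] at h
      refine h.congr fun g => ?_
      ring
    have h := hnum.div hden one_ne_zero
    rw [div_one] at h
    refine h.congr' ?_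
    filter_upwards [eventually_ge_atTop (w / Real.pi), eventually_gt_atTop 0] with g hg hg0
    have : w ∈ Set.Ioc 0 (g * Real.pi) := ⟨hw, (div_le_iff₀ hπ).1 hg⟩
    simp only [hΦ, Set.indicator_of_mem this, Pi.div_apply]
  have hmeas : ∀ g, AEStronglyMeasurable (Φ g) (volume.restrict (Set.Ioi 0)) := by
    intro g
    have := (continuous_hoytExponent q).measurable
    exact (Measurable.indicator (by fun_prop) measurableSet_Ioc).aestronglyMeasurable
  have hlim := tendsto_integral_filter_of_dominated_convergence
    (μ := volume.restrict (Set.Ioi (0 : ℝ))) (F := Φ) (l := atTop)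
    (fun w => Real.exp (-(κ / Real.pi ^ 2) * w ^ 2))
    (Eventually.of_forall hmeas)
    (by
      filter_upwards [eventually_gt_atTop 0] with g hg
      exact (ae_restrict_iff' measurableSet_Ioi).2 (Eventually.of_forall (hdom g hg)))
    ((integrable_exp_neg_mul_sq (by positivity)).integrableOn)
    ((ae_restrict_iff' measurableSet_Ioi).2 (Eventually.of_forall hptw))
  rw [integral_gaussian_Ioi] at hlim
  have h := (hlim.const_mul (1 / (Real.pi * q))).congr' hrew
  convert h using 2
  have e : Real.pi / (κ / 4) = (2 * Real.pi * q) ^ 2 * 4 / ((1 - q ^ 2) * (2 * Real.pi)) := by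
    rw [hκdef]; field_simp
  rw [e, show (2 * Real.pi * q) ^ 2 * 4 = (2 * Real.pi * q * 2) ^ 2 by ring,
    Real.sqrt_div (by positivity), Real.sqrt_sq (by positivity), Real.sqrt_mul h1q.le]
  field_simp

/-- Mills' ratio: `-exp (-y² / 2) / y` is a primitive of `(1 + 1 / y²) exp (-y² / 2)`, which
compares the tail integral with its asymptotic form from both sides. -/
theorem tendsto_mul_gaussQ :
    Tendsto (fun g : ℝ => g * Real.exp (g ^ 2 / 2) * gaussQ g) atTop
      (𝓝 (1 / Real.sqrt (2 * Real.pi))) := by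
  set T : ℝ → ℝ := fun g => ∫ y in Set.Ioi g, Real.exp (-y ^ 2 / 2) with hT
  have hprim : ∀ g : ℝ, 0 < g → IntegrableOn (fun y => (1 + 1 / y ^ 2) * Real.exp (-y ^ 2 / 2))
      (Set.Ioi g) ∧ ∫ y in Set.Ioi g, (1 + 1 / y ^ 2) * Real.exp (-y ^ 2 / 2)
        = Real.exp (-g ^ 2 / 2) / g := by
    intro g hg
    have hd : ∀ y ∈ Set.Ici g, HasDerivAt (fun y => -(Real.exp (-y ^ 2 / 2) / y))
        ((1 + 1 / y ^ 2) * Real.exp (-y ^ 2 / 2)) y := by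
      intro y hy
      have hy0 : y ≠ 0 := (hg.trans_le hy).ne'
      have h := (((((hasDerivAt_pow 2 y).neg.div_const 2).exp).div (hasDerivAt_id y) hy0)).neg
      refine h.congr_deriv ?_
      simp only [Pi.neg_apply, id]
      field_simp
      ring
    have hnn : ∀ y ∈ Set.Ioi g, 0 ≤ (1 + 1 / y ^ 2) * Real.exp (-y ^ 2 / 2) :=
      fun y _ => by positivity
    have hl : Tendsto (fun y : ℝ => -(Real.exp (-y ^ 2 / 2) / y)) atTop (𝓝 0) := by
      have h1 : Tendsto (fun y : ℝ => 1 / 2 * y ^ 2) atTop atTop :=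
        (tendsto_pow_atTop two_ne_zero).const_mul_atTop (by norm_num)
      have h2 := ((Real.tendsto_exp_neg_atTop_nhds_zero.comp h1).div_atTop tendsto_id).neg
      rw [neg_zero] at h2
      refine h2.congr fun y => ?_
      simp only [Function.comp, id]
      congr 3; ring
    refine ⟨integrableOn_Ioi_deriv_of_nonneg' hd hnn hl, ?_⟩
    rw [integral_Ioi_of_hasDerivAt_of_nonneg' hd hnn hl]; ring
  have hbound : ∀ g : ℝ, 0 < g → T g ≤ Real.exp (-g ^ 2 / 2) / g ∧
      Real.exp (-g ^ 2 / 2) / g ≤ (1 + 1 / g ^ 2) * T g := by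
    intro g hg
    obtain ⟨hi, he⟩ := hprim g hg
    have hTi : IntegrableOn (fun y : ℝ => Real.exp (-y ^ 2 / 2)) (Set.Ioi g) :=
      integrable_half_gaussian.integrableOn
    constructor
    · rw [← he]
      refine setIntegral_mono_on hTi hi measurableSet_Ioi fun y hy => ?_
      exact le_mul_of_one_le_left (Real.exp_pos _).le
        (by have : 0 ≤ 1 / y ^ 2 := by positivity
            linarith)
    · rw [← he, hT, ← integral_const_mul]
      refine setIntegral_mono_on hi (hTi.const_mul _) measurableSet_Ioi fun y hy => ?_
      have : g ≤ y := le_of_lt hy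
      gcongr
  have hlim : Tendsto (fun g : ℝ => g * Real.exp (g ^ 2 / 2) * T g) atTop (𝓝 1) := by
    have hlow : Tendsto (fun g : ℝ => 1 / (1 + 1 / g ^ 2)) atTop (𝓝 1) := by
      have h1 : Tendsto (fun g : ℝ => 1 / g ^ 2) atTop (𝓝 0) :=
        tendsto_const_nhds.div_atTop (tendsto_pow_atTop two_ne_zero)
      have h2 := (tendsto_const_nhds (x := (1 : ℝ))).div (h1.const_add 1) (by norm_num)
      rw [add_zero, div_one] at h2
      exact h2
    refine tendsto_of_tendsto_of_tendsto_of_le_of_le' hlow tendsto_const_nhds ?_ ?_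
    · filter_upwards [eventually_gt_atTop 0] with g hg
      have h := (hbound g hg).2
      rw [div_le_iff₀ (by positivity)]
      have h2 := mul_le_mul_of_nonneg_left h (by positivity : 0 ≤ g * Real.exp (g ^ 2 / 2))
      have h3 : g * Real.exp (g ^ 2 / 2) * (Real.exp (-g ^ 2 / 2) / g) = 1 := by
        rw [neg_div, Real.exp_neg]; field_simp
      rw [h3] at h2
      linarith
    · filter_upwards [eventually_gt_atTop 0] with g hg
      have h2 := mul_le_mul_of_nonneg_left (hbound g hg).1
        (by positivity : 0 ≤ g * Real.exp (g ^ 2 / 2))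
      have h3 : g * Real.exp (g ^ 2 / 2) * (Real.exp (-g ^ 2 / 2) / g) = 1 := by
        rw [neg_div, Real.exp_neg]; field_simp
      rwa [h3] at h2
  have h := hlim.div_const (Real.sqrt (2 * Real.pi))
  refine h.congr fun g => ?_
  rw [gaussQ, integral_div, mul_div_assoc]

/-- The leading exponential order of the tail, also in the isotropic case `q = 1`. -/
theorem tendsto_log_hoytTail_div_sq {q : ℝ} (hq : 0 < q) (hq1 : q ≤ 1) :
    Tendsto (fun g : ℝ => Real.log (hoytTail q (g ^ 2)) / g ^ 2) atTop (𝓝 (-(1 / 2))) := by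
  rcases hq1.eq_or_lt with rfl | hlt
  · refine tendsto_const_nhds.congr' ?_
    filter_upwards [eventually_gt_atTop 0] with g hg
    rw [hoytTail_one, Real.log_exp]
    field_simp
  have hC : 0 < 2 / Real.sqrt (1 - q ^ 2) * (1 / Real.sqrt (2 * Real.pi)) := by
    have : 0 < Real.sqrt (1 - q ^ 2) := Real.sqrt_pos.2 (by nlinarith)
    have := Real.pi_pos
    positivity
  have h := tendsto_mul_hoytTail hq hlt
  have hsq : Tendsto (fun g : ℝ => g ^ 2) atTop atTop := tendsto_pow_atTop two_ne_zero
  have h1 := (h.log hC.ne').div_atTop hsq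
  have h2 : Tendsto (fun g : ℝ => Real.log g / g ^ 2) atTop (𝓝 0) := by
    have h3 := (Real.tendsto_pow_log_div_mul_add_atTop 1 0 1 one_ne_zero).div_atTop tendsto_id
    refine h3.congr fun g => ?_
    simp only [pow_one, one_mul, add_zero, id]
    rw [div_div, sq]
  have h4 := (h1.sub h2).sub_const (1 / 2)
  rw [sub_zero, zero_sub] at h4
  refine h4.congr' ?_
  filter_upwards [eventually_gt_atTop 0, h.eventually (lt_mem_nhds hC)] with g hg hpos
  have hP : 0 < hoytTail q (g ^ 2) := pos_of_mul_pos_right hpos (by positivity)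
  rw [Real.log_mul (by positivity) hP.ne', Real.log_mul hg.ne' (by positivity), Real.log_exp]
  field_simp
  ring

theorem isEquivalent_of_tendsto_mul {α : Type*} {l : Filter α} {φ f h : α → ℝ} {C : ℝ}
    (hC : C ≠ 0) (hφ : ∀ᶠ x in l, φ x ≠ 0) (hf : Tendsto (fun x => φ x * f x) l (𝓝 C))
    (hh : Tendsto (fun x => φ x * h x) l (𝓝 C)) : f ~[l] h := by
  have h1 : (fun x => φ x * f x) ~[l] fun x => φ x * h x :=
    ((isEquivalent_const_iff_tendsto hC).2 hf).trans
      ((isEquivalent_const_iff_tendsto hC).2 hh).symm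
  have h2 := (IsEquivalent.refl (u := fun x => (φ x)⁻¹) (l := l)).mul h1
  refine (h2.congr_left ?_).congr_right ?_ <;>
  · filter_upwards [hφ] with x hx
    simp only [Pi.mul_apply]
    rw [inv_mul_cancel_left₀ hx]

/-! ### The law of the footprint center -/

theorem UAVCoord.sum_univ (f : UAVCoord → ℝ) :
    ∑ i, f i = f .x + f .y + f .z + f .θ + f .φ := by
  change ∑ i ∈ ({.x, .y, .z, .θ, .φ} : Finset UAVCoord), f i = _
  simp only [Finset.sum_insert, Finset.mem_insert, Finset.mem_singleton, reduceCtorEq, or_self,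
    not_false_eq_true, Finset.sum_singleton]
  ring

section LinearCombination

variable {ι S : Type*} [Fintype ι] [MeasurableSpace S] {P : Measure S}
  {ε : ι → S → ℝ} {v : ι → ℝ≥0}

theorem hasGaussianLaw_linearCombination_pair (hlaw : ∀ i, HasLaw (ε i) (gaussianReal 0 (v i)) P)
    (hind : iIndepFun ε P) (α β : ι → ℝ) :
    HasGaussianLaw (fun s => (∑ i, α i * ε i s, ∑ i, β i * ε i s)) P := by
  have h := hind.hasGaussianLaw fun i => (hlaw i).hasGaussianLaw
  let L : (ι → ℝ) →L[ℝ] ℝ × ℝ :=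
    (∑ i, α i • ContinuousLinearMap.proj i).prod (∑ i, β i • ContinuousLinearMap.proj i)
  have e : (fun s => (∑ i, α i * ε i s, ∑ i, β i * ε i s)) = fun s => L fun i => ε i s := by
    ext s <;> simp [L]
  rw [e]
  exact h.map_fun L

theorem covariance_linearCombination [IsProbabilityMeasure P]
    (hlaw : ∀ i, HasLaw (ε i) (gaussianReal 0 (v i)) P) (hind : iIndepFun ε P) (α β : ι → ℝ) :
    cov[fun s => ∑ i, α i * ε i s, fun s => ∑ i, β i * ε i s; P]
      = ∑ i, α i * β i * (v i : ℝ) := by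
  classical
  have hL : ∀ i, MemLp (ε i) 2 P := fun i => (hlaw i).hasGaussianLaw.memLp_two
  rw [covariance_fun_sum_fun_sum (fun i => (hL i).const_mul _) (fun i => (hL i).const_mul _)]
  refine Finset.sum_congr rfl fun i _ => ?_
  rw [Finset.sum_eq_single i]
  · rw [covariance_const_mul_left, covariance_const_mul_right,
      covariance_self (hlaw i).aemeasurable, (hlaw i).variance_eq, variance_id_gaussianReal]
    ring
  · intro j _ hj
    rw [covariance_const_mul_left, covariance_const_mul_right,
      (hind.indepFun hj.symm).covariance_eq_zero (hL i) (hL j)]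
    simp
  · simp

theorem integral_linearCombination (hlaw : ∀ i, HasLaw (ε i) (gaussianReal 0 (v i)) P)
    (α : ι → ℝ) : ∫ s, ∑ i, α i * ε i s ∂P = 0 := by
  rw [integral_finsetSum _ fun i _ => (hlaw i).hasGaussianLaw.integrable.const_mul _]
  refine Finset.sum_eq_zero fun i _ => ?_
  rw [integral_const_mul, (hlaw i).integral_eq, integral_id_gaussianReal, mul_zero]

end LinearCombination

namespace UAVLink

variable (p : UAVLink)

/-- Coefficients, in terms of the fluctuations, of the footprint center's coordinate along the
`i`-th eigenvector of its covariance matrix. -/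
noncomputable def principalCoeff (i : Fin 2) : UAVCoord → ℝ
  | .x => p.sigmaIG_isHermitian.eigenvectorBasis i 0 * p.c₁
      + p.sigmaIG_isHermitian.eigenvectorBasis i 1 * p.c₅
  | .y => p.sigmaIG_isHermitian.eigenvectorBasis i 0
  | .z => p.sigmaIG_isHermitian.eigenvectorBasis i 1
  | .θ => p.sigmaIG_isHermitian.eigenvectorBasis i 0 * p.c₂
      + p.sigmaIG_isHermitian.eigenvectorBasis i 1 * p.c₄
  | .φ => p.sigmaIG_isHermitian.eigenvectorBasis i 1 * p.c₃

theorem sum_principalCoeff (i : Fin 2) (ε : UAVCoord → ℝ) :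
    ∑ k, p.principalCoeff i k * ε k
      = p.sigmaIG_isHermitian.eigenvectorBasis i 0 * p.footprintY ε
        + p.sigmaIG_isHermitian.eigenvectorBasis i 1 * p.footprintZ ε := by
  rw [UAVCoord.sum_univ]
  simp only [principalCoeff, footprintY, footprintZ]
  ring

theorem sq_footprint_eq_sum_sq (ε : UAVCoord → ℝ) :
    p.footprintY ε ^ 2 + p.footprintZ ε ^ 2
      = (∑ k, p.principalCoeff 0 k * ε k) ^ 2 + (∑ k, p.principalCoeff 1 k * ε k) ^ 2 := by
  have h := p.sigmaIG_isHermitian.eigenvectorBasis.sum_sq_norm_inner_right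
    !₂[p.footprintY ε, p.footprintZ ε]
  rw [EuclideanSpace.norm_sq_eq, Fin.sum_univ_two, Fin.sum_univ_two] at h
  simp only [PiLp.inner_apply, Fin.sum_univ_two, Real.norm_eq_abs, sq_abs] at h
  simp at h
  rw [sum_principalCoeff, sum_principalCoeff, ← h]
  ring

theorem sum_principalCoeff_mul (i j : Fin 2) :
    ∑ k, p.principalCoeff i k * p.principalCoeff j k * ((p.σ k ^ 2 : ℝ≥0) : ℝ)
      = if i = j then p.eig i else 0 := by
  rw [UAVCoord.sum_univ]
  simp only [principalCoeff, NNReal.coe_pow]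
  have h1 := p.sigmaIG_isHermitian.mulVec_eigenvectorBasis j
  have h2 := (orthonormal_iff_ite.1 p.sigmaIG_isHermitian.eigenvectorBasis.orthonormal) i j
  rw [PiLp.inner_apply, Fin.sum_univ_two] at h2
  have e (k : Fin 2) : p.sigmaIG k 0 * p.sigmaIG_isHermitian.eigenvectorBasis j 0
      + p.sigmaIG k 1 * p.sigmaIG_isHermitian.eigenvectorBasis j 1
      = p.eig j * p.sigmaIG_isHermitian.eigenvectorBasis j k := by
    have h := congrFun h1 k
    rw [Matrix.mulVec, dotProduct, Fin.sum_univ_two] at h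
    exact h
  have e0 := e 0
  have e1 := e 1
  replace h2 : p.sigmaIG_isHermitian.eigenvectorBasis j 0
      * p.sigmaIG_isHermitian.eigenvectorBasis i 0
      + p.sigmaIG_isHermitian.eigenvectorBasis j 1
      * p.sigmaIG_isHermitian.eigenvectorBasis i 1 = if i = j then 1 else 0 := h2
  generalize p.sigmaIG_isHermitian.eigenvectorBasis = V at *
  simp only [sigmaIG, Matrix.of_apply, Matrix.cons_val_zero, Matrix.cons_val_one,
    Matrix.cons_val', Matrix.cons_val_fin_one] at e0 e1
  have hr : (if i = j then p.eig i else 0) = p.eig j * (if i = j then 1 else 0) := by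
    split_ifs with h
    · rw [h, mul_one]
    · rw [mul_zero]
  rw [hr, ← h2]
  linear_combination V i 0 * e0 + V i 1 * e1

variable {p}
variable {S : Type*} [MeasurableSpace S] {P : Measure S} [IsProbabilityMeasure P]
  {ε : UAVCoord → S → ℝ}

theorem eig_nonneg (i : Fin 2) : 0 ≤ p.eig i := by
  have h := p.sum_principalCoeff_mul i i
  rw [if_pos rfl] at h
  rw [← h]
  exact Finset.sum_nonneg fun k _ => mul_nonneg (mul_self_nonneg _) (NNReal.coe_nonneg _)

theorem eig_pos (hq : 0 < p.q) (i : Fin 2) : 0 < p.eig i := by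
  have hm : 0 < min (p.eig 0) (p.eig 1) := by
    refine (le_min (eig_nonneg 0) (eig_nonneg 1)).lt_of_ne' fun h => ?_
    rw [q, h, zero_div, Real.sqrt_zero] at hq
    exact hq.false
  fin_cases i
  · exact hm.trans_le (min_le_left _ _)
  · exact hm.trans_le (min_le_right _ _)

/-- In the principal axes the footprint center has independent Gaussian coordinates, whose
variances are the eigenvalues. -/
theorem real_sq_footprint_ge
    (hlaw : ∀ i, HasLaw (ε i) (gaussianReal 0 (p.σ i ^ 2)) P) (hind : iIndepFun ε P)
    (hq : 0 < p.q) {ρ : ℝ} (hρ : 0 ≤ ρ) :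
    P.real {s | ρ ≤ p.footprintY (fun i => ε i s) ^ 2 + p.footprintZ (fun i => ε i s) ^ 2}
      = hoytTail p.q (ρ / max (p.eig 0) (p.eig 1)) := by
  set W : Fin 2 → S → ℝ := fun i s => ∑ k, p.principalCoeff i k * ε k s with hW
  have hG : HasGaussianLaw (fun s => (W 0 s, W 1 s)) P :=
    hasGaussianLaw_linearCombination_pair hlaw hind _ _
  have hcov : ∀ i j, cov[W i, W j; P] = if i = j then p.eig i else 0 := fun i j => by
    rw [← sum_principalCoeff_mul]
    exact covariance_linearCombination hlaw hind _ _
  have hindW : IndepFun (W 0) (W 1) P := hG.indepFun_of_covariance_eq_zero (by simp [hcov])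
  have hGi : ∀ i, HasGaussianLaw (W i) P := by
    intro i; fin_cases i
    · exact hG.fst
    · exact hG.snd
  have hmap : ∀ i, P.map (W i) = gaussianReal 0 (p.eig i).toNNReal := fun i => by
    rw [(hGi i).map_eq_gaussianReal, ← covariance_self (hGi i).aemeasurable, hcov, if_pos rfl]
    congr 1
    exact integral_linearCombination hlaw _
  have hprod := (indepFun_iff_map_prod_eq_prod_map_map (hGi 0).aemeasurable
    (hGi 1).aemeasurable).1 hindW
  have hm : MeasurableSet {z : ℝ × ℝ | ρ ≤ z.1 ^ 2 + z.2 ^ 2} :=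
    measurableSet_le measurable_const (by fun_prop)
  have hset : {s | ρ ≤ p.footprintY (fun i => ε i s) ^ 2 + p.footprintZ (fun i => ε i s) ^ 2}
      = (fun s => (W 0 s, W 1 s)) ⁻¹' {z : ℝ × ℝ | ρ ≤ z.1 ^ 2 + z.2 ^ 2} := by
    ext s
    change ρ ≤ _ ↔ ρ ≤ _
    rw [sq_footprint_eq_sum_sq]
  have hne : ∀ i, (p.eig i).toNNReal ≠ 0 := fun i => (Real.toNNReal_pos.2 (eig_pos hq i)).ne'
  have h := gaussianReal_prod_radius_tail_eq_hoytTail (hne 0) (hne 1) hρ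
  rw [Real.coe_toNNReal _ (eig_nonneg 0), Real.coe_toNNReal _ (eig_nonneg 1)] at h
  rw [hset, measureReal_def, ← Measure.map_apply_of_aemeasurable hG.aemeasurable hm, hprod, hmap,
    hmap, ← measureReal_def, h, q]

end UAVLink

namespace UAVLink

variable {p : UAVLink}

/-! ### The outage event -/

theorem q_le_one : p.q ≤ 1 := by
  refine Real.sqrt_le_one.2 (div_le_one_of_le₀ min_le_max ?_)
  exact (eig_nonneg 0).trans (le_max_left _ _)

theorem max_eig_pos (hq : 0 < p.q) : 0 < max (p.eig 0) (p.eig 1) :=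
  (eig_pos hq 0).trans_le (le_max_left _ _)

theorem spread_eq (hq : 0 < p.q) :
    p.spread = (1 + p.q ^ 2) * max (p.eig 0) (p.eig 1) := by
  have hM := max_eig_pos hq
  have hm : 0 < min (p.eig 0) (p.eig 1) := lt_min (eig_pos hq 0) (eig_pos hq 1)
  rw [q, Real.sq_sqrt (by positivity), spread, ← min_add_max (p.eig 0)]
  field_simp
  ring

/-- Outage means that the footprint center leaves a disc around the center of the lens. -/
theorem snr_le_iff (hA₀ : 0 < p.A₀) (ht : 0 < p.t) (hwL : 0 < p.wL) (hη : 0 < p.η)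
    (hhp : 0 < p.hp) (hγthr : 0 < p.γthr) {γ : ℝ} (hγ : 0 < γ) (ε : UAVCoord → ℝ) :
    p.snr γ ε ≤ p.γthr ↔ p.t * p.wL ^ 2 / 2
        * Real.log (p.η * p.hp * p.A₀ * Real.sqrt γ / Real.sqrt p.γthr)
      ≤ p.footprintY ε ^ 2 + p.footprintZ ε ^ 2 := by
  set u := p.footprintY ε ^ 2 + p.footprintZ ε ^ 2 with hu
  set X := p.η * p.hp * p.A₀ * Real.sqrt γ / Real.sqrt p.γthr with hX
  have hsγ : 0 < Real.sqrt γ := Real.sqrt_pos.2 hγ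
  have hsthr : 0 < Real.sqrt p.γthr := Real.sqrt_pos.2 hγthr
  have hX0 : 0 < X := by positivity
  have hu0 : 0 ≤ u := by positivity
  set E := Real.exp (2 * u / (p.t * p.wL ^ 2)) with hE
  have hsnr : p.snr γ ε = (X / E) ^ 2 * p.γthr := by
    rw [snr, gml, misalignment, Real.sq_sqrt hu0, Real.exp_neg, ← hE, hX]
    have h1 := Real.sq_sqrt hγ.le
    have h2 := Real.sq_sqrt hγthr.le
    have hE0 : E ≠ 0 := (Real.exp_pos _).ne'
    field_simp
    rw [h1, h2]
  rw [hsnr, mul_le_iff_le_one_left hγthr, sq_le_one_iff₀ (by positivity),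
    div_le_one (Real.exp_pos _), ← Real.log_le_iff_le_exp hX0, le_div_iff₀ (by positivity)]
  constructor <;> intro h <;> linarith

variable {S : Type*} [MeasurableSpace S] {P : Measure S} [IsProbabilityMeasure P]
  {ε : UAVCoord → S → ℝ}

theorem log_nonneg_of_le (hη : 0 < p.η) (hhp : 0 < p.hp) (hγthr : 0 < p.γthr)
    {γ : ℝ} (hγ : 0 < γ) (h : Real.sqrt p.γthr / (p.η * p.hp * Real.sqrt γ) ≤ p.A₀) :
    0 ≤ Real.log (p.η * p.hp * p.A₀ * Real.sqrt γ / Real.sqrt p.γthr) := by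
  have hsγ : 0 < Real.sqrt γ := Real.sqrt_pos.2 hγ
  have hsthr : 0 < Real.sqrt p.γthr := Real.sqrt_pos.2 hγthr
  rw [div_le_iff₀ (by positivity)] at h
  refine Real.log_nonneg ((one_le_div hsthr).2 ?_)
  linarith

theorem g_sq (hq : 0 < p.q) (ht : 0 < p.t) {γ : ℝ}
    (h : 0 ≤ Real.log (p.η * p.hp * p.A₀ * Real.sqrt γ / Real.sqrt p.γthr)) :
    p.g γ ^ 2 = p.t * p.wL ^ 2 / 2
      * Real.log (p.η * p.hp * p.A₀ * Real.sqrt γ / Real.sqrt p.γthr)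
      / max (p.eig 0) (p.eig 1) := by
  have hM := max_eig_pos hq
  have hs : 0 < p.spread := by rw [spread_eq hq]; positivity
  rw [g, Real.sq_sqrt (by positivity), spread_eq hq]
  field_simp

theorem outage_eq_hoytTail
    (hlaw : ∀ i, HasLaw (ε i) (gaussianReal 0 (p.σ i ^ 2)) P) (hind : iIndepFun ε P)
    (hA₀ : 0 < p.A₀) (ht : 0 < p.t) (hwL : 0 < p.wL) (hη : 0 < p.η) (hhp : 0 < p.hp)
    (hγthr : 0 < p.γthr) (hq : 0 < p.q) {γ : ℝ} (hγ : 0 < γ)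
    (h : Real.sqrt p.γthr / (p.η * p.hp * Real.sqrt γ) ≤ p.A₀) :
    p.outage P ε γ = hoytTail p.q (p.g γ ^ 2) := by
  have hlog := log_nonneg_of_le hη hhp hγthr hγ h
  simp only [outage, snr_le_iff hA₀ ht hwL hη hhp hγthr hγ]
  rw [real_sq_footprint_ge hlaw hind hq (by positivity), g_sq hq ht hlog]

/-! ### Large transmit SNR -/

theorem eventually_threshold_le (hA₀ : 0 < p.A₀) (hη : 0 < p.η) (hhp : 0 < p.hp) :
    ∀ᶠ γ : ℝ in atTop, Real.sqrt p.γthr / (p.η * p.hp * Real.sqrt γ) ≤ p.A₀ := by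
  have h : Tendsto (fun γ : ℝ => Real.sqrt p.γthr / (p.η * p.hp * Real.sqrt γ)) atTop (𝓝 0) :=
    tendsto_const_nhds.div_atTop (Real.tendsto_sqrt_atTop.const_mul_atTop (by positivity))
  exact (h.eventually (gt_mem_nhds hA₀)).mono fun γ hγ => hγ.le

theorem bT_pos (hA₀ : 0 < p.A₀) (hη : 0 < p.η) (hhp : 0 < p.hp) (hγthr : 0 < p.γthr) :
    0 < p.bT := by
  have := Real.sqrt_pos.2 hγthr
  unfold bT; positivity

/-- With `d` the diversity order, `g² = 2 d log (γ / bT²)` once the logarithm is nonnegative. -/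
theorem g_sq_eq (hA₀ : 0 < p.A₀) (ht : 0 < p.t) (hη : 0 < p.η) (hhp : 0 < p.hp)
    (hγthr : 0 < p.γthr) (hq : 0 < p.q) {γ : ℝ} (hγ : 0 < γ)
    (h : Real.sqrt p.γthr / (p.η * p.hp * Real.sqrt γ) ≤ p.A₀) :
    p.g γ ^ 2 = 2 * ((1 + p.q ^ 2) * p.t * p.wL ^ 2 / (8 * p.spread))
      * Real.log (γ / p.bT ^ 2) := by
  have hM := max_eig_pos hq
  have hsγ : 0 < Real.sqrt γ := Real.sqrt_pos.2 hγ
  have hsthr : 0 < Real.sqrt p.γthr := Real.sqrt_pos.2 hγthr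
  have e : γ / p.bT ^ 2 = (p.η * p.hp * p.A₀ * Real.sqrt γ / Real.sqrt p.γthr) ^ 2 := by
    rw [bT]
    field_simp
    rw [Real.sq_sqrt hγ.le]
  rw [g_sq hq ht (log_nonneg_of_le hη hhp hγthr hγ h), e, Real.log_pow, spread_eq hq]
  field_simp
  push_cast
  ring

theorem tendsto_g_atTop (hA₀ : 0 < p.A₀) (ht : 0 < p.t) (hwL : 0 < p.wL) (hη : 0 < p.η)
    (hhp : 0 < p.hp) (hγthr : 0 < p.γthr) (hq : 0 < p.q) : Tendsto p.g atTop atTop := by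
  have hM := max_eig_pos hq
  have hs : 0 < p.spread := by rw [spread_eq hq]; positivity
  have hsthr : 0 < Real.sqrt p.γthr := Real.sqrt_pos.2 hγthr
  refine Real.tendsto_sqrt_atTop.comp (Tendsto.const_mul_atTop (by positivity) ?_)
  exact Real.tendsto_log_atTop.comp ((Real.tendsto_sqrt_atTop.const_mul_atTop
    (by positivity)).atTop_div_const hsthr)

/-- Only the difference `a - b = g` depends on the transmit SNR; the ratio `a / b` does not. -/
theorem sqrt_div_add_sqrt_div (hq : 0 < p.q) (hq1 : p.q < 1) {γ : ℝ} (hg : 0 < p.g γ) :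
    Real.sqrt (p.a γ / p.b γ) + Real.sqrt (p.b γ / p.a γ) = 2 / Real.sqrt (1 - p.q ^ 2) := by
  have h1 : 0 < 1 - p.q := by linarith
  have h2 : 0 < 1 + p.q := by linarith
  have s1 := Real.sqrt_pos.2 h1
  have s2 := Real.sqrt_pos.2 h2
  have e1 : p.a γ / p.b γ = (1 + p.q) / (1 - p.q) := by
    rw [a, b]; field_simp
  have e2 : p.b γ / p.a γ = (1 - p.q) / (1 + p.q) := by
    rw [a, b]; field_simp
  rw [e1, e2, Real.sqrt_div h2.le, Real.sqrt_div h1.le,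
    show 1 - p.q ^ 2 = (1 - p.q) * (1 + p.q) by ring, Real.sqrt_mul h1.le]
  field_simp
  rw [Real.sq_sqrt h1.le, Real.sq_sqrt h2.le]
  ring

theorem a_sub_b (hq : 0 < p.q) (γ : ℝ) : p.a γ - p.b γ = p.g γ := by
  rw [a, b]; field_simp; ring

/-- The elementary asymptotic form is exactly the leading constant over `g exp (g² / 2)`. -/
theorem mul_elementary_asymptotic (hA₀ : 0 < p.A₀) (ht : 0 < p.t) (hwL : 0 < p.wL)
    (hη : 0 < p.η) (hhp : 0 < p.hp) (hγthr : 0 < p.γthr) (hq : 0 < p.q) (hq1 : p.q < 1) {γ : ℝ}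
    (hγ : 0 < γ) (h : Real.sqrt p.γthr / (p.η * p.hp * Real.sqrt γ) ≤ p.A₀) (hg : 0 < p.g γ) :
    p.g γ * Real.exp (p.g γ ^ 2 / 2)
      * (p.aT * (1 / γ) ^ ((1 + p.q ^ 2) * p.t * p.wL ^ 2 / (8 * p.spread))
          * Real.log (γ / p.bT ^ 2) ^ (-(1 / 2) : ℝ))
      = 2 / Real.sqrt (1 - p.q ^ 2) * (1 / Real.sqrt (2 * Real.pi)) := by
  have hM := max_eig_pos hq
  have hs : 0 < p.spread := by rw [spread_eq hq]; positivity
  have hb := bT_pos hA₀ hη hhp hγthr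
  have hgsq := g_sq_eq hA₀ ht hη hhp hγthr hq hγ h
  set d := (1 + p.q ^ 2) * p.t * p.wL ^ 2 / (8 * p.spread) with hd
  have hd0 : 0 < d := by positivity
  set L := Real.log (γ / p.bT ^ 2) with hL
  have hL0 : 0 < L := by
    have : 0 < 2 * d * L := by rw [← hgsq]; positivity
    exact pos_of_mul_pos_right this (by positivity)
  have h1q : 0 < 1 - p.q ^ 2 := by nlinarith
  have hexp : Real.exp (p.g γ ^ 2 / 2) = γ ^ d / p.bT ^ (2 * d) := by
    rw [hgsq, show 2 * d * L / 2 = L * d by ring, hL, ← Real.rpow_def_of_pos (by positivity),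
      Real.div_rpow hγ.le (by positivity), ← Real.rpow_natCast, ← Real.rpow_mul hb.le]
    norm_num
  have hgv : p.g γ = Real.sqrt (2 * d) * Real.sqrt L := by
    rw [← Real.sqrt_mul (by positivity), ← hgsq, Real.sqrt_sq hg.le]
  have hLp : L ^ (-(1 / 2) : ℝ) = (Real.sqrt L)⁻¹ := by
    rw [Real.rpow_neg hL0.le, Real.sqrt_eq_rpow]
  have h1γ : (1 / γ) ^ d = (γ ^ d)⁻¹ := by rw [one_div, Real.inv_rpow hγ.le]
  have haT : p.aT = 2 * Real.sqrt (2 * p.spread) * p.bT ^ (2 * d)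
      / Real.sqrt (Real.pi * (1 - p.q ^ 4) * p.t * p.wL ^ 2) := by
    rw [aT, show (1 + p.q ^ 2) * p.t * p.wL ^ 2 / (4 * p.spread) = 2 * d by
      rw [hd]; field_simp; norm_num]
  have hconst : Real.sqrt (2 * d) * (2 * Real.sqrt (2 * p.spread))
      / Real.sqrt (Real.pi * (1 - p.q ^ 4) * p.t * p.wL ^ 2)
      = 2 / Real.sqrt (1 - p.q ^ 2) * (1 / Real.sqrt (2 * Real.pi)) := by
    have hπ := Real.pi_pos
    have hT : 0 < (1 + p.q ^ 2) * p.t * p.wL ^ 2 / 2 := by positivity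
    rw [show Real.pi * (1 - p.q ^ 4) * p.t * p.wL ^ 2
      = (1 + p.q ^ 2) * p.t * p.wL ^ 2 / 2 * ((1 - p.q ^ 2) * (2 * Real.pi)) by ring,
      Real.sqrt_mul hT.le, Real.sqrt_mul h1q.le, mul_left_comm, ← Real.sqrt_mul (by positivity),
      show 2 * d * (2 * p.spread) = (1 + p.q ^ 2) * p.t * p.wL ^ 2 / 2 by
        rw [hd]; field_simp; norm_num]
    have := Real.sqrt_pos.2 hT
    field_simp
  have hγd : γ ^ d ≠ 0 := (Real.rpow_pos_of_pos hγ _).ne'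
  have hbd : p.bT ^ (2 * d) ≠ 0 := (Real.rpow_pos_of_pos hb _).ne'
  have hsL : Real.sqrt L ≠ 0 := (Real.sqrt_pos.2 hL0).ne'
  rw [← hconst, hexp, hgv, hLp, h1γ, haT]
  field_simp

end UAVLink

theorem mainTheorem7 (p : UAVLink) {S : Type*} [MeasurableSpace S] (P : Measure S)
    [IsProbabilityMeasure P] (ε : UAVCoord → S → ℝ)
    (hlaw : ∀ i, HasLaw (ε i) (gaussianReal 0 (p.σ i ^ 2)) P)
    (hind : iIndepFun ε P)
    (hμx : p.μx ≠ 0) (hA₀ : 0 < p.A₀) (ht : 0 < p.t) (hwL : 0 < p.wL)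
    (hη : 0 < p.η) (hhp : 0 < p.hp) (hγthr : 0 < p.γthr) (hq : 0 < p.q) :
    -- the outage probability in terms of Marcum Q-functions
    (∀ γ : ℝ, 0 < γ → Real.sqrt p.γthr / (p.η * p.hp * Real.sqrt γ) ≤ p.A₀ →
      p.outage P ε γ = 1 - marcumQ (p.a γ) (p.b γ) + marcumQ (p.b γ) (p.a γ)) ∧
    -- its asymptotic behavior for large transmit SNR
    (p.q < 1 →
      (p.outage P ε ~[atTop] fun γ =>
        (Real.sqrt (p.a γ / p.b γ) + Real.sqrt (p.b γ / p.a γ)) * gaussQ (p.a γ - p.b γ)) ∧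
      (p.outage P ε ~[atTop] fun γ =>
        p.aT * (1 / γ) ^ ((1 + p.q ^ 2) * p.t * p.wL ^ 2 / (8 * p.spread))
          * Real.log (γ / p.bT ^ 2) ^ (-(1 / 2) : ℝ))) ∧
    -- the diversity order
    Tendsto (fun γ => -(Real.log (p.outage P ε γ) / Real.log γ)) atTop
      (𝓝 ((1 + p.q ^ 2) * p.t * p.wL ^ 2 / (8 * p.spread))) := by
  have hout : ∀ γ : ℝ, 0 < γ → Real.sqrt p.γthr / (p.η * p.hp * Real.sqrt γ) ≤ p.A₀ →
      p.outage P ε γ = hoytTail p.q (p.g γ ^ 2) := fun γ hγ h =>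
    UAVLink.outage_eq_hoytTail hlaw hind hA₀ ht hwL hη hhp hγthr hq hγ h
  have hev := UAVLink.eventually_threshold_le hA₀ hη hhp
  have hg := UAVLink.tendsto_g_atTop hA₀ ht hwL hη hhp hγthr hq
  have hq1 := UAVLink.q_le_one (p := p)
  refine ⟨fun γ hγ h => ?_, fun hlt => ?_, ?_⟩
  · rw [hout γ hγ h]
    exact (one_sub_marcumQ_add_marcumQ_eq_hoytTail hq hq1 (Real.sqrt_nonneg _)).symm
  · have hC : 2 / Real.sqrt (1 - p.q ^ 2) * (1 / Real.sqrt (2 * Real.pi)) ≠ 0 := by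
      have : 0 < Real.sqrt (1 - p.q ^ 2) := Real.sqrt_pos.2 (by nlinarith)
      have := Real.pi_pos
      positivity
    have hφ : ∀ᶠ γ in atTop, p.g γ * Real.exp (p.g γ ^ 2 / 2) ≠ 0 := by
      filter_upwards [hg.eventually_gt_atTop 0] with γ hγ
      positivity
    have hf : Tendsto (fun γ => p.g γ * Real.exp (p.g γ ^ 2 / 2) * p.outage P ε γ) atTop
        (𝓝 (2 / Real.sqrt (1 - p.q ^ 2) * (1 / Real.sqrt (2 * Real.pi)))) := by
      refine ((tendsto_mul_hoytTail hq hlt).comp hg).congr' ?_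
      filter_upwards [hev, eventually_gt_atTop 0] with γ h hγ
      rw [hout γ hγ h, Function.comp]
    refine ⟨isEquivalent_of_tendsto_mul hC hφ hf ?_, isEquivalent_of_tendsto_mul hC hφ hf ?_⟩
    · refine ((tendsto_mul_gaussQ.comp hg).const_mul (2 / Real.sqrt (1 - p.q ^ 2))).congr' ?_
      filter_upwards [hg.eventually_gt_atTop 0] with γ hγ
      rw [UAVLink.a_sub_b hq, UAVLink.sqrt_div_add_sqrt_div hq hlt hγ, Function.comp]
      ring
    · refine tendsto_const_nhds.congr' ?_
      filter_upwards [hev, eventually_gt_atTop 0, hg.eventually_gt_atTop 0] with γ h hγ hgγ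
      exact (UAVLink.mul_elementary_asymptotic hA₀ ht hwL hη hhp hγthr hq hlt hγ h hgγ).symm
  · set d := (1 + p.q ^ 2) * p.t * p.wL ^ 2 / (8 * p.spread) with hd
    -- `g² / log γ → 2 d`, since `log (γ / bT²)` and `log γ` differ by a constant
    have h1 : Tendsto (fun γ => p.g γ ^ 2 / Real.log γ) atTop (𝓝 (2 * d)) := by
      have h2 : Tendsto (fun γ : ℝ => 2 * d * (1 - Real.log (p.bT ^ 2) / Real.log γ)) atTop
          (𝓝 (2 * d * (1 - 0))) :=
        ((tendsto_const_nhds.div_atTop Real.tendsto_log_atTop).const_sub 1).const_mul _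
      rw [sub_zero, mul_one] at h2
      refine h2.congr' ?_
      filter_upwards [hev, eventually_gt_atTop 1] with γ h hγ
      have hγ0 : 0 < γ := by linarith
      have hl : 0 < Real.log γ := Real.log_pos hγ
      have hb := UAVLink.bT_pos hA₀ hη hhp hγthr
      rw [UAVLink.g_sq_eq hA₀ ht hη hhp hγthr hq hγ0 h, ← hd,
        Real.log_div hγ0.ne' (by positivity)]
      field_simp
    have h3 := (((tendsto_log_hoytTail_div_sq hq hq1).comp hg).mul h1).neg
    rw [show -(-(1 / 2) * (2 * d)) = d by ring] at h3
    refine h3.congr' ?_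
    filter_upwards [hev, eventually_gt_atTop 1, hg.eventually_gt_atTop 0] with γ h hγ hgγ
    rw [hout γ (by linarith) h, Function.comp]
    field_simp
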